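/- Let $\mathcal M\subset\{2,3,\dots\}$ be a non-empty finite set with maximum $M$. For $n\ge 1$ and $m\in\mathcal M$ let $\mathcal Q^{(m)}$ be a symmetric order-$m$ tensor on $[n]$ with entries in $[0,1]$, written $\mathcal Q^{(m)}_{i_1\dots i_m}=d^{(m)}_{i_1\dots i_m}/\binom{n-1}{m-1}$ (for $n<m$ put $d^{(m)}_{i_1\dots i_m}=0$). Let $H=\bigcup_{m\in\mathcal M}H_m$ be the inhomogeneous non-uniform Erdős–Rényi random hypergraph on $[n]$: all hyperedges appear independently, and an $m$-subset $\{i_1,\dots,i_m\}$, $m\in\mathcal M$, is a hyperedge with probability $\mathcal Q^{(m)}_{i_1\dots i_m}$. Put $d_{\max}=\sum_{m\in\mathcal M}\max_{i_1,\dots,i_m\in[n]}d^{(m)}_{i_1\dots i_m}$; no lower bound on $d_{\max}$ is assumed. Let $d_v$ be the number of hyperedges containing the vertex $v$, $\bar d=n^{-1}\sum_v d_v$, and let $A$ be the adjacency matrix: $A_{ii}=0$, and for $i\ne j$, $A_{ij}$ is the number of hyperedges containing both $i$ and $j$. For $J\subseteq[n]$ and an $n\times n$ matrix $B$ let $(B_J)_{ij}=\mathbf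 1\{i,j\in J\}B_{ij}$; write $\mathbb E A_J:=(\mathbb E A)_J$, and let $\|\cdot\|$ be the Euclidean operator norm. Let $\rho_n=\max_v\mathbb E d_v$, $\xi_n=n^{-1}\sum_v\mathbb E d_v$, $\zeta_n=\rho_n/\log n$, $\gamma_n=\xi_n/\log n$. Set $$C=10M^2+2\beta,\quad \beta=\beta_0\sqrt{\beta_1}+M,\quad \beta_0=16+32M(1+e^2)+1792(1+e^{-2})M^2,\quad \beta_1=M,$$ and consider the bound $$(\ast)\qquad \|A_J-\mathbb E A_J\|\le C\sqrt{d_{\max}}.$$ 1. Let $J_1$ be obtained from $[n]$ by removing $\lfloor n e^{-\bar d}\rfloor$ vertices with the largest $d_v$. For every $\kappa>0$ there is a $c>0$, depending only on $\kappa$ and $\mathcal M$, such that for every $n\geq 1$ and every such $H$ with $\zeta_n\log(\zeta_n/\gamma_n)\ge\kappa$ (in particular $n\ge 2$ and $\rho_n>0$), with probability at least $1-2(e/2)^{-n}-2n^{-c}$ the bound $(\ast)$ holds for $J=J_1$, whichever way ties are broken. 2. Let $J_2=\{v\in[n]:d_v\le M d_{\max}\}$. For every $n\geq 1$ and every such $H$,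 the bound $(\ast)$ holds for $J=J_2$ with probability at least $1-2(e/2)^{-n}-n^{-10}$. -/

import Mathlib

open MeasureTheory ProbabilityTheory

namespace NonUniformHypergraph

noncomputable section

/-- The hyperedge set of a hypergraph on the vertex set `[n]`. Its `m`-uniform layer consists of the
hyperedges with `m` elements, so layers of different sizes never share a hyperedge. -/
abbrev Hypergraph (n : ℕ) : Type := Finset (Finset (Fin n))

/-- The adjacency matrix: off the diagonal, the number of hyperedges (of any size) that contain both
vertices; zero on the diagonal. -/
def adjMatrix {n : ℕ} (H : Hypergraph n) : Matrix (Fin n) (Fin n) ℝ :=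
  Matrix.of fun i j => if i = j then 0 else ((H.filter fun e => i ∈ e ∧ j ∈ e).card : ℝ)

/-- The degree of a vertex: the number of hyperedges that contain it. -/
def degree {n : ℕ} (H : Hypergraph n) (v : Fin n) : ℕ :=
  (H.filter fun e => v ∈ e).card

/-- The sample average degree. -/
def avgDegree {n : ℕ} (H : Hypergraph n) : ℝ :=
  (∑ v, (degree H v : ℝ)) / n

/-- The matrix obtained by zeroing out the rows and columns not indexed by `J`. -/
def regularize {n : ℕ} (J : Finset (Fin n)) (B : Matrix (Fin n) (Fin n) ℝ) :
    Matrix (Fin n) (Fin n) ℝ :=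
  Matrix.of fun i j => if i ∈ J ∧ j ∈ J then B i j else 0

/-- The Euclidean operator norm of a square matrix. -/
def opNorm {n : ℕ} (B : Matrix (Fin n) (Fin n) ℝ) : ℝ :=
  ‖Matrix.toEuclideanCLM (𝕜 := ℝ) B‖

/-- `J` is obtained from `[n]` by removing `⌊n exp (-d̄)⌋` vertices of largest degree, where `d̄` is the
sample average degree; ties may be broken in any way. -/
def IsTopDegreeTrimming {n : ℕ} (H : Hypergraph n) (J : Finset (Fin n)) : Prop :=
  Jᶜ.card = ⌊(n : ℝ) * Real.exp (-avgDegree H)⌋₊ ∧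
    ∀ v ∈ J, ∀ u ∉ J, degree H v ≤ degree H u

/-- The vertices of degree at most `t`. -/
def lowDegree {n : ℕ} (H : Hypergraph n) (t : ℝ) : Finset (Fin n) :=
  Finset.univ.filter fun v => (degree H v : ℝ) ≤ t

/-- `Q m` is a symmetric order-`m` tensor with entries in `[0, 1]`, for every `m ∈ 𝓜`. -/
structure IsProbTensor {n : ℕ} (𝓜 : Finset ℕ) (Q : (m : ℕ) → (Fin m → Fin n) → ℝ) : Prop where
  nonneg : ∀ m ∈ 𝓜, ∀ i, 0 ≤ Q m i
  le_one : ∀ m ∈ 𝓜, ∀ i, Q m i ≤ 1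
  symm : ∀ m ∈ 𝓜, ∀ (σ : Equiv.Perm (Fin m)) (i : Fin m → Fin n), Q m (i ∘ σ) = Q m i

/-- `H` is an inhomogeneous non-uniform Erdős–Rényi random hypergraph: all hyperedge sizes lie in
`𝓜`, hyperedges appear independently, and `{i₁, …, iₘ}` appears with probability `Q m i`. -/
structure IsErdosRenyi {n : ℕ} {Ω : Type*} [MeasurableSpace Ω] (P : Measure Ω) (𝓜 : Finset ℕ)
    (Q : (m : ℕ) → (Fin m → Fin n) → ℝ) (H : Ω → Hypergraph n) : Prop where
  tensor : IsProbTensor 𝓜 Q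
  card_mem : ∀ ω, ∀ e ∈ H ω, e.card ∈ 𝓜
  measurableSet : ∀ e, MeasurableSet {ω | e ∈ H ω}
  indep : iIndepSet (fun e => {ω | e ∈ H ω}) P
  prob : ∀ m ∈ 𝓜, ∀ i : Fin m → Fin n, Function.Injective i →
    P.real {ω | Finset.univ.image i ∈ H ω} = Q m i

/-- `d_max = ∑_{m ∈ 𝓜} max_{i₁, …, iₘ} d^{(m)}_{i₁ … iₘ}`, where `Q = d / (n-1 choose m-1)`. -/
def dMax {n : ℕ} (𝓜 : Finset ℕ) (Q : (m : ℕ) → (Fin m → Fin n) → ℝ) : ℝ :=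
  ∑ m ∈ 𝓜, ⨆ i : Fin m → Fin n, ((n - 1).choose (m - 1) : ℝ) * Q m i

/-- The entrywise expectation of the adjacency matrix. -/
def meanAdjMatrix {n : ℕ} {Ω : Type*} [MeasurableSpace Ω] (P : Measure Ω)
    (H : Ω → Hypergraph n) : Matrix (Fin n) (Fin n) ℝ :=
  Matrix.of fun i j => ∫ ω, adjMatrix (H ω) i j ∂P

/-- `ρ`: the maximum expected degree. -/
def maxMeanDegree {n : ℕ} {Ω : Type*} [MeasurableSpace Ω] (P : Measure Ω)
    (H : Ω → Hypergraph n) : ℝ :=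
  ⨆ v : Fin n, ∫ ω, (degree (H ω) v : ℝ) ∂P

/-- `ξ`: the average expected degree. -/
def avgMeanDegree {n : ℕ} {Ω : Type*} [MeasurableSpace Ω] (P : Measure Ω)
    (H : Ω → Hypergraph n) : ℝ :=
  (∫ ω, ∑ v, (degree (H ω) v : ℝ) ∂P) / n

/-- `ζ = ρ / log n`. -/
def zeta {n : ℕ} {Ω : Type*} [MeasurableSpace Ω] (P : Measure Ω) (H : Ω → Hypergraph n) : ℝ :=
  maxMeanDegree P H / Real.log n

/-- `γ = ξ / log n`. -/
def gamma {n : ℕ} {Ω : Type*} [MeasurableSpace Ω] (P : Measure Ω) (H : Ω → Hypergraph n) : ℝ :=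
  avgMeanDegree P H / Real.log n

/-- `β₀ = 16 + 32 M (1 + e²) + 1792 (1 + e⁻²) M²`. -/
def beta0 (M : ℝ) : ℝ :=
  16 + 32 * M * (1 + Real.exp 2) + 1792 * (1 + Real.exp (-2)) * M ^ 2

/-- `C = 10 M² + 2 β` with `β = β₀ √β₁ + M` and `β₁ = M`. -/
def concConst (M : ℝ) : ℝ :=
  10 * M ^ 2 + 2 * (beta0 M * Real.sqrt M + M)

end

end NonUniformHypergraph

open NonUniformHypergraph

/-! The proof follows the method of Kahn–Szemerédi and Feige–Ofek. Write d for d_max. A quarter-net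
of the unit ball with at most 9^n points reduces the operator norm to bilinear forms at pairs of net
points, at the cost of a factor 16/9 (`exists_finite_net`). For such a pair x, y, the index pairs
(u, v) are split at |x_u y_v| = √d / n.

Light pairs: their part of the centred form is linear in the independent hyperedge indicators, and
one hyperedge carries at most M(M-1) ordered pairs, so an exponential moment gives a tail e^(-6n).
This beats a union over 81^n pairs of net points and all 2^n vertex sets J, so the bound holds for
every J at once, in particular for a J that depends on the hypergraph (`prob_not_lightBound_le`).

Heavy pairs: the mean matrix has entries at most 2(M-1)d/n, so its part is O(√d) deterministically.
For the adjacency matrix the coordinates are grouped into dyadic levels, and two facts suffice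
(`heavy_sum_le`): row sums in J are O(d), and every block sum is either comparable to its mean bound
or controlled by the entropy of one of its sides. The second fact concerns the whole matrix and
fails with probability at most n^(-10), by Chernoff and a union over pairs of vertex sets
(`prob_not_boundedDiscrepancy_le`).

Hence, outside an event of probability (e/2)^(-n) + n^(-10), the bound holds simultaneously for all
J whose vertices have degree at most 11Md (`prob_not_concentratesOnModerate_le`). The low-degree set
is one of them by definition. For the trimmed set, let ξ be the larger of 1/8 and the mean average
degree; the sample average is at most 2ξ with high probability. If the mean average is below 1/8,
then only isolated vertices survive. Otherwise a survivor of degree above 11Md would produce ⌈n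
e^(-2ξ)⌉ vertices of that degree, which Chernoff rules out (`prob_not_trimmingModerate_le`). -/

namespace NonUniformHypergraph

/-! ### Nets of the unit ball and the operator norm -/

/-- A `1/4`-separated subset of the unit ball of a Euclidean space has at most `9 ^ dim` points. -/
theorem card_le_of_quarter_separated {E : Type*} [NormedAddCommGroup E] [NormedSpace ℝ E]
    [FiniteDimensional ℝ E] (s : Finset E) (hs : ∀ c ∈ s, ‖c‖ ≤ 1)
    (h : ∀ c ∈ s, ∀ d ∈ s, c ≠ d → 1 / 4 ≤ ‖c - d‖) :
    s.card ≤ 9 ^ Module.finrank ℝ E := by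
  borelize E
  let μ : Measure E := Measure.addHaar
  have δpos : (0 : ℝ) < 1 / 8 := by norm_num
  have ρpos : (0 : ℝ) < 9 / 8 := by norm_num
  have D : Set.Pairwise (s : Set E)
      (Function.onFun Disjoint fun c => Metric.ball (c : E) (1 / 8)) := by
    rintro c hc d hd hcd
    apply Metric.ball_disjoint_ball
    rw [dist_eq_norm]
    have := h c hc d hd hcd
    linarith
  -- Volume comparison: disjoint balls of radius 1/8 inside the ball of radius 9/8, whence the ratio
  -- 9.
  have hsub : (⋃ c ∈ s, Metric.ball (c : E) (1 / 8)) ⊆ Metric.ball (0 : E) (9 / 8) := by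
    refine Set.iUnion₂_subset fun x hx => ?_
    apply Metric.ball_subset_ball'
    rw [dist_zero_right]
    linarith [hs x hx]
  have I : (s.card : ENNReal) * ENNReal.ofReal ((1 / 8) ^ Module.finrank ℝ E) *
      μ (Metric.ball 0 1) ≤
      ENNReal.ofReal ((9 / 8) ^ Module.finrank ℝ E) * μ (Metric.ball 0 1) :=
    calc
      _ = μ (⋃ c ∈ s, Metric.ball (c : E) (1 / 8)) := by
        rw [measure_biUnion_finset D fun c _ => measurableSet_ball]
        simp only [μ.addHaar_ball_of_pos _ δpos]
        simp only [Finset.sum_const, nsmul_eq_mul, mul_assoc]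
      _ ≤ μ (Metric.ball (0 : E) (9 / 8)) := measure_mono hsub
      _ = _ := by simp only [μ.addHaar_ball_of_pos _ ρpos]
  have J := (ENNReal.mul_le_mul_iff_left (Metric.measure_ball_pos _ _ zero_lt_one).ne'
    measure_ball_lt_top.ne).1 I
  have K := ENNReal.toReal_le_of_le_ofReal (pow_nonneg ρpos.le _) J
  have K' : (s.card : ℝ) ≤ (9 : ℝ) ^ Module.finrank ℝ E := by
    simpa [div_eq_mul_inv, mul_pow] using K
  exact_mod_cast K'

/-- The unit ball of a Euclidean space has a `1/4`-net with at most `9 ^ dim` points. -/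
theorem exists_quarter_net (E : Type*) [NormedAddCommGroup E] [NormedSpace ℝ E]
    [FiniteDimensional ℝ E] :
    ∃ N : Finset E, (∀ c ∈ N, ‖c‖ ≤ 1) ∧ (∀ x : E, ‖x‖ ≤ 1 → ∃ c ∈ N, ‖x - c‖ ≤ 1 / 4) ∧
      N.card ≤ 9 ^ Module.finrank ℝ E := by
  classical
  let P : ℕ → Prop := fun k => ∃ s : Finset E, (∀ c ∈ s, ‖c‖ ≤ 1) ∧
    (∀ c ∈ s, ∀ d ∈ s, c ≠ d → 1 / 4 ≤ ‖c - d‖) ∧ s.card = k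
  have hP0 : P 0 := ⟨∅, by simp, by simp, by simp⟩
  -- A separated set of largest cardinality is a net: a point far from all of it could be added. The
  -- volume bound caps the search.
  obtain ⟨s, h1, h2, h3⟩ : P (Nat.findGreatest P (9 ^ Module.finrank ℝ E)) :=
    Nat.findGreatest_spec (m := 0) (Nat.zero_le _) hP0
  refine ⟨s, h1, fun x hx => ?_, card_le_of_quarter_separated s h1 h2⟩
  by_contra! hcon
  have hxs : x ∉ s := fun hxs => by
    have := hcon x hxs
    norm_num at this
  have h1' : ∀ c ∈ insert x s, ‖c‖ ≤ 1 := by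
    intro c hc
    rcases Finset.mem_insert.1 hc with rfl | hc
    · exact hx
    · exact h1 c hc
  have h2' : ∀ c ∈ insert x s, ∀ d ∈ insert x s, c ≠ d → 1 / 4 ≤ ‖c - d‖ := by
    intro c hc d hd hcd
    rcases Finset.mem_insert.1 hc with hc | hc <;> rcases Finset.mem_insert.1 hd with hd | hd
    · exact absurd (hc.trans hd.symm) hcd
    · rw [hc]; exact (hcon d hd).le
    · rw [hd, norm_sub_rev]; exact (hcon c hc).le
    · exact h2 c hc d hd hcd
  have hle := card_le_of_quarter_separated _ h1' h2'
  have := Nat.le_findGreatest (P := P) hle ⟨insert x s, h1', h2', rfl⟩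
  rw [Finset.card_insert_of_notMem hxs, h3] at this
  omega

/-- The operator norm is controlled by the bilinear form on a `1/4`-net of the unit ball. -/
theorem norm_le_of_quarter_net {E : Type*} [NormedAddCommGroup E] [InnerProductSpace ℝ E]
    (T : E →L[ℝ] E) (N : Finset E) (hN : ∀ x : E, ‖x‖ ≤ 1 → ∃ c ∈ N, ‖x - c‖ ≤ 1 / 4) {K : ℝ}
    (hK0 : 0 ≤ K) (hK : ∀ x ∈ N, ∀ y ∈ N, inner ℝ x (T y) ≤ K) : ‖T‖ ≤ 16 / 9 * K := by
  -- The net is used twice, for each argument of the form; each use costs 1 / (1 - 1/4) = 4/3.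
  have vec : ∀ w : E, (∀ x ∈ N, inner ℝ x w ≤ K) → ‖w‖ ≤ 4 / 3 * K := by
    intro w hw
    rcases eq_or_ne w 0 with rfl | hw0
    · simpa using hK0
    have hpos : 0 < ‖w‖ := norm_pos_iff.2 hw0
    obtain ⟨c, hc, hcu⟩ := hN (‖w‖⁻¹ • w) (by rw [norm_smul, norm_inv, norm_norm]; field_simp; rfl)
    have e1 : inner ℝ (‖w‖⁻¹ • w) w = ‖w‖ := by
      rw [real_inner_smul_left, real_inner_self_eq_norm_sq]; field_simp
    have e2 : inner ℝ (‖w‖⁻¹ • w - c) w ≤ 1 / 4 * ‖w‖ :=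
      (real_inner_le_norm _ _).trans (by gcongr)
    rw [inner_sub_left, e1] at e2
    linarith [hw c hc]
  have hT : ‖T‖ ≤ 4 / 3 * K + ‖T‖ * (1 / 4) := by
    refine ContinuousLinearMap.opNorm_le_of_unit_norm (by positivity) fun u hu => ?_
    obtain ⟨c, hc, hcu⟩ := hN u hu.le
    have h1 : ‖T (u - c)‖ ≤ ‖T‖ * (1 / 4) := (T.le_opNorm _).trans (by gcongr)
    have h2 := vec (T c) fun x hx => hK x hx c hc
    have h3 : T u = T c + T (u - c) := by rw [map_sub]; abel
    rw [h3]
    exact (norm_add_le _ _).trans (add_le_add h2 h1)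
  linarith

/-- The inner product against a matrix, in coordinates. -/
theorem inner_toEuclideanCLM {n : ℕ} (B : Matrix (Fin n) (Fin n) ℝ)
    (x y : EuclideanSpace ℝ (Fin n)) :
    inner ℝ x (Matrix.toEuclideanCLM (𝕜 := ℝ) B y) = ∑ u, ∑ v, x u * y v * B u v := by
  have h : (Matrix.toEuclideanCLM (𝕜 := ℝ) B y) = WithLp.toLp 2 (Matrix.mulVec B y.ofLp) := by
    rw [← Matrix.toEuclideanCLM_toLp]
  rw [h, PiLp.inner_apply]
  refine Finset.sum_congr rfl fun u _ => ?_
  simp only [Matrix.mulVec, dotProduct, RCLike.inner_apply, conj_trivial]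
  rw [Finset.sum_mul]
  exact Finset.sum_congr rfl fun v _ => by ring

/-- The operator norm of a matrix is controlled by its bilinear form on a finite net of the
Euclidean unit ball. -/
theorem exists_finite_net (n : ℕ) :
    ∃ N : Finset (EuclideanSpace ℝ (Fin n)), N.card ≤ 9 ^ n ∧ (∀ x ∈ N, ∑ u, x u ^ 2 ≤ 1) ∧
      ∀ (B : Matrix (Fin n) (Fin n) ℝ) (K : ℝ), 0 ≤ K →
        (∀ x ∈ N, ∀ y ∈ N, ∑ u, ∑ v, x u * y v * B u v ≤ K) → opNorm B ≤ 16 / 9 * K := by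
  obtain ⟨N, h1, h2, h3⟩ := exists_quarter_net (EuclideanSpace ℝ (Fin n))
  refine ⟨N, by simpa using h3, fun x hx => ?_, fun B K hK0 hK => ?_⟩
  · have := h1 x hx
    rw [← EuclideanSpace.real_norm_sq_eq]
    exact pow_le_one₀ (norm_nonneg _) this
  · refine norm_le_of_quarter_net _ N h2 hK0 fun x hx y hy => ?_
    rw [inner_toEuclideanCLM]
    exact hK x hx y hy

/-! ### Sums over random hyperedges: exponential moments and Chernoff bounds -/

/-- The probability that `e` is a hyperedge. -/
noncomputable def edgeProb {n : ℕ} {Ω : Type*} [MeasurableSpace Ω] (P : Measure Ω)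
    (H : Ω → Hypergraph n) (e : Finset (Fin n)) : ℝ := P.real {ω | e ∈ H ω}

/-- The total weight of the hyperedges of a hypergraph. -/
def edgeSum {n : ℕ} (w : Finset (Fin n) → ℝ) (h : Hypergraph n) : ℝ := ∑ e ∈ h, w e

theorem edgeProb_nonneg {n : ℕ} {Ω : Type*} [MeasurableSpace Ω] {P : Measure Ω}
    {H : Ω → Hypergraph n} (e : Finset (Fin n)) : 0 ≤ edgeProb P H e := measureReal_nonneg

theorem edgeSum_eq_sum_indicator {n : ℕ} {Ω : Type*} {H : Ω → Hypergraph n} (w : Finset (Fin n) → ℝ) (ω : Ω) :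
    edgeSum w (H ω) = ∑ e, w e * ({ω | e ∈ H ω}.indicator (fun _ => (1 : ℝ)) ω) := by
  simp only [edgeSum, Set.indicator_apply, Set.mem_ofPred_eq, mul_ite, mul_one, mul_zero]
  rw [← Finset.sum_filter]
  congr 1
  ext e
  simp

section Moments

variable {n : ℕ} {Ω : Type*} [MeasurableSpace Ω] {P : Measure Ω} [IsProbabilityMeasure P]
  {H : Ω → Hypergraph n}

theorem measurable_comp_hypergraph (hm : ∀ e, MeasurableSet {ω | e ∈ H ω})
    (F : Hypergraph n → ℝ) : Measurable fun ω => F (H ω) := by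
  let _ : MeasurableSpace (Hypergraph n) := ⊤
  have hH : Measurable H := by
    refine measurable_to_countable' fun h => ?_
    have : H ⁻¹' {h} = ⋂ e, {ω | e ∈ H ω ↔ e ∈ h} := by
      ext ω
      simp [Finset.ext_iff]
    rw [this]
    refine MeasurableSet.iInter fun e => ?_
    by_cases he : e ∈ h
    · simpa [he] using hm e
    · simp only [he, iff_false]
      exact (hm e).compl
  exact measurable_from_top.comp hH

theorem integrable_comp_hypergraph (hm : ∀ e, MeasurableSet {ω | e ∈ H ω})
    (F : Hypergraph n → ℝ) : Integrable (fun ω => F (H ω)) P := by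
  refine Integrable.of_bound (measurable_comp_hypergraph hm F).aestronglyMeasurable
    (∑ h, |F h|) (Filter.Eventually.of_forall fun ω => ?_)
  exact Finset.single_le_sum (f := fun h => |F h|) (fun _ _ => abs_nonneg _) (Finset.mem_univ _)

theorem integral_edgeSum (hm : ∀ e, MeasurableSet {ω | e ∈ H ω}) (w : Finset (Fin n) → ℝ) :
    ∫ ω, edgeSum w (H ω) ∂P = ∑ e, w e * edgeProb P H e := by
  simp_rw [edgeSum_eq_sum_indicator]
  rw [integral_finsetSum]
  · refine Finset.sum_congr rfl fun e _ => ?_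
    rw [integral_const_mul]
    congr 1
    exact integral_indicator_one (hm e)
  · intro e _
    exact ((integrable_const (1 : ℝ)).indicator (hm e)).const_mul _

/-- Independence factorises the expectation into Bernoulli factors 1 + p(e^c - 1), each at most
exp(p(e^c - 1)). The weights may have either sign. -/
theorem integral_exp_edgeSum_le (hm : ∀ e, MeasurableSet {ω | e ∈ H ω})
    (hi : iIndepSet (fun e => {ω | e ∈ H ω}) P) (c : Finset (Fin n) → ℝ) :
    ∫ ω, Real.exp (edgeSum c (H ω)) ∂P ≤
      Real.exp (∑ e, edgeProb P H e * (Real.exp (c e) - 1)) := by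
  have hind := hi.iIndepFun_indicator (β := ℝ) (m := Real.measurableSpace)
  have hmeas : ∀ e, Measurable ({ω | e ∈ H ω}.indicator fun _ : Ω => (1 : ℝ)) := fun e =>
    measurable_const.indicator (hm e)
  have key := hind.integral_fun_prod_comp (f := fun e (z : ℝ) => Real.exp (c e * z))
    (fun e => (hmeas e).aemeasurable)
    (fun e => (by fun_prop : Continuous fun z : ℝ => Real.exp (c e * z)).aestronglyMeasurable)
  simp_rw [edgeSum_eq_sum_indicator, Real.exp_sum]
  rw [key]
  refine Finset.prod_le_prod (fun e _ => integral_nonneg fun ω => (Real.exp_pos _).le)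
    fun e _ => ?_
  have heq : (fun ω => Real.exp (c e * ({ω | e ∈ H ω}.indicator (fun _ => (1 : ℝ)) ω))) =
      fun ω => 1 + (Real.exp (c e) - 1) * ({ω | e ∈ H ω}.indicator (fun _ => (1 : ℝ)) ω) := by
    ext ω
    by_cases h : e ∈ H ω <;> simp [h]
  have hint : Integrable ({ω | e ∈ H ω}.indicator fun _ : Ω => (1 : ℝ)) P :=
    (integrable_const (1 : ℝ)).indicator (hm e)
  calc ∫ ω, Real.exp (c e * ({ω | e ∈ H ω}.indicator (fun _ => (1 : ℝ)) ω)) ∂P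
      = 1 + (Real.exp (c e) - 1) * edgeProb P H e := by
        rw [heq, integral_add (integrable_const _) (hint.const_mul _), integral_const_mul]
        have : ∫ ω, ({ω | e ∈ H ω}.indicator (fun _ => (1 : ℝ)) ω) ∂P = edgeProb P H e :=
          integral_indicator_one (hm e)
        rw [this]
        simp
    _ ≤ Real.exp (edgeProb P H e * (Real.exp (c e) - 1)) := by
        rw [mul_comm, add_comm]
        exact Real.add_one_le_exp _

/-- Markov's inequality for the exponential. With signed weights it serves the light pairs;
`chernoff_edgeSum` is its nonnegative case, tilted by log k / W. -/
theorem prob_le_edgeSum_le (hm : ∀ e, MeasurableSet {ω | e ∈ H ω})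
    (hi : iIndepSet (fun e => {ω | e ∈ H ω}) P) (c : Finset (Fin n) → ℝ) (t : ℝ) :
    P.real {ω | t ≤ edgeSum c (H ω)} ≤
      Real.exp (-t + ∑ e, edgeProb P H e * (Real.exp (c e) - 1)) := by
  have h1 := mul_meas_ge_le_integral_of_nonneg (μ := P)
    (f := fun ω => Real.exp (edgeSum c (H ω)))
    (Filter.Eventually.of_forall fun ω => (Real.exp_pos _).le)
    (integrable_comp_hypergraph hm fun h => Real.exp (edgeSum c h)) (Real.exp t)
  have h2 := h1.trans (integral_exp_edgeSum_le hm hi c)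
  simp only [Real.exp_le_exp] at h2
  rw [Real.exp_add, Real.exp_neg]
  rw [← div_eq_inv_mul, le_div_iff₀ (Real.exp_pos t), mul_comm]
  exact h2

/-- Chernoff's bound for a sum of independent weighted hyperedge indicators. -/
theorem chernoff_edgeSum (hm : ∀ e, MeasurableSet {ω | e ∈ H ω})
    (hi : iIndepSet (fun e => {ω | e ∈ H ω}) P) {w : Finset (Fin n) → ℝ} {W μ k : ℝ}
    (hW : 0 < W) (hw0 : ∀ e, 0 ≤ w e) (hwW : ∀ e, edgeProb P H e ≠ 0 → w e ≤ W)
    (hμ : ∑ e, w e * edgeProb P H e ≤ μ) (hk : 1 ≤ k) :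
    P.real {ω | k * μ ≤ edgeSum w (H ω)} ≤ Real.exp (-(μ / W) * (k * Real.log k - k + 1)) := by
  have hk0 : 0 < k := by linarith
  have hlog : 0 ≤ Real.log k := Real.log_nonneg hk
  have h1 := prob_le_edgeSum_le hm hi (fun e => Real.log k / W * w e) (Real.log k / W * (k * μ))
  have hsub : {ω | k * μ ≤ edgeSum w (H ω)} ⊆
      {ω | Real.log k / W * (k * μ) ≤ edgeSum (fun e => Real.log k / W * w e) (H ω)} := by
    intro ω hω
    simp only [edgeSum, Set.mem_ofPred_eq, ← Finset.mul_sum] at hω ⊢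
    gcongr
  refine (measureReal_mono hsub).trans (h1.trans ?_)
  rw [Real.exp_le_exp]
  have hterm : ∀ e, edgeProb P H e * (Real.exp (Real.log k / W * w e) - 1) ≤
      w e * edgeProb P H e * ((k - 1) / W) := by
    intro e
    by_cases hp : edgeProb P H e = 0
    · simp [hp]
    have hwe := hwW e hp
    have ha : 0 ≤ 1 - w e / W := by rw [sub_nonneg, div_le_one hW]; exact hwe
    -- The chord of exp on [0, log k] bounds k^(w/W) by 1 + (w/W)(k - 1).
    have hconv := convexOn_exp.2 (Set.mem_univ 0) (Set.mem_univ (Real.log k)) ha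
      (div_nonneg (hw0 e) hW.le) (by ring)
    simp only [smul_eq_mul, mul_zero, zero_add, Real.exp_zero, Real.exp_log hk0] at hconv
    have e1 : Real.log k / W * w e = w e / W * Real.log k := by ring
    rw [e1]
    calc edgeProb P H e * (Real.exp (w e / W * Real.log k) - 1)
        ≤ edgeProb P H e * (w e / W * (k - 1)) := by
          refine mul_le_mul_of_nonneg_left ?_ (edgeProb_nonneg e)
          linarith
      _ = _ := by ring
  have hsum : ∑ e, edgeProb P H e * (Real.exp (Real.log k / W * w e) - 1) ≤
      μ * ((k - 1) / W) := by
    refine (Finset.sum_le_sum fun e _ => hterm e).trans ?_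
    rw [← Finset.sum_mul]
    exact mul_le_mul_of_nonneg_right hμ (div_nonneg (by linarith) hW.le)
  calc _ ≤ -(Real.log k / W * (k * μ)) + μ * ((k - 1) / W) := by linarith
    _ = _ := by ring

/-- The Chernoff bound for a family of large values, in terms of the smallest of them. -/
theorem prob_large_edgeSum_le (hm : ∀ e, MeasurableSet {ω | e ∈ H ω})
    (hi : iIndepSet (fun e => {ω | e ∈ H ω}) P) {w : Finset (Fin n) → ℝ} {W μ τ : ℝ}
    (hW : 0 < W) (hw0 : ∀ e, 0 ≤ w e) (hwW : ∀ e, edgeProb P H e ≠ 0 → w e ≤ W)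
    (hμ : ∑ e, w e * edgeProb P H e ≤ μ) (hμ0 : 0 < μ) (B : Hypergraph n → Prop)
    (hB1 : ∀ h, B h → Real.exp 2 * μ ≤ edgeSum w h)
    (hB2 : ∀ h, B h → 2 * W * τ ≤ edgeSum w h * Real.log (edgeSum w h / μ)) :
    P.real {ω | B (H ω)} ≤ Real.exp (-τ) := by
  classical
  rcases (Finset.univ.filter B).eq_empty_or_nonempty with hE | hE
  · have : {ω | B (H ω)} = ∅ := by
      ext ω
      have := Finset.filter_eq_empty_iff.1 hE (Finset.mem_univ (H ω))
      simpa using this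
    rw [this]
    simpa using (Real.exp_pos _).le
  -- There are finitely many hypergraphs, so `B` has a member of least edge sum, and the event lies
  -- in a single upper tail starting there. The threshold k log k never has to be inverted.
  obtain ⟨h₀, hh₀, hmin⟩ := Finset.exists_min_image _ (edgeSum w) hE
  replace hh₀ : B h₀ := (Finset.mem_filter.1 hh₀).2
  set k := edgeSum w h₀ / μ with hk
  have hkμ : edgeSum w h₀ = k * μ := by rw [hk]; field_simp
  have hke : Real.exp 2 ≤ k := by rw [hk, le_div_iff₀ hμ0]; exact hB1 h₀ hh₀
  have hk1 : 1 ≤ k := (Real.one_le_exp (by norm_num)).trans hke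
  have hlog : 2 ≤ Real.log k := by rw [Real.le_log_iff_exp_le (by linarith)]; exact hke
  have hsub : {ω | B (H ω)} ⊆ {ω | k * μ ≤ edgeSum w (H ω)} := by
    intro ω hω
    have := hmin (H ω) (Finset.mem_filter.2 ⟨Finset.mem_univ _, hω⟩)
    rw [hkμ] at this
    exact this
  refine (measureReal_mono hsub).trans ((chernoff_edgeSum hm hi hW hw0 hwW hμ hk1).trans ?_)
  rw [Real.exp_le_exp]
  have h2 := hB2 h₀ hh₀
  rw [← hk, hkμ] at h2
  have h3 : τ ≤ μ / W * (k * Real.log k / 2) := by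
    rw [div_mul_eq_mul_div, le_div_iff₀ hW]
    linarith
  have h4 : k * Real.log k / 2 ≤ k * Real.log k - k + 1 := by nlinarith
  have h5 := mul_le_mul_of_nonneg_left h4 (div_pos hμ0 hW).le
  linarith

end Moments

/-! ### Adjacency matrix, degrees and their expectations -/

theorem adjMatrix_eq_edgeSum {n : ℕ} (h : Hypergraph n) (u v : Fin n) :
    adjMatrix h u v = edgeSum (fun e => if u ≠ v ∧ u ∈ e ∧ v ∈ e then 1 else 0) h := by
  by_cases huv : u = v
  · simp [adjMatrix, edgeSum, huv]
  · simp [adjMatrix, edgeSum, huv]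

theorem degree_eq_edgeSum {n : ℕ} (h : Hypergraph n) (v : Fin n) :
    (degree h v : ℝ) = edgeSum (fun e => if v ∈ e then 1 else 0) h := by
  simp [degree, edgeSum]

theorem adjMatrix_nonneg {n : ℕ} (h : Hypergraph n) (u v : Fin n) : 0 ≤ adjMatrix h u v := by
  rw [adjMatrix_eq_edgeSum]
  exact Finset.sum_nonneg fun e _ => by positivity

theorem adjMatrix_symm {n : ℕ} (h : Hypergraph n) (u v : Fin n) :
    adjMatrix h u v = adjMatrix h v u := by
  simp only [adjMatrix_eq_edgeSum, ne_comm (a := u) (b := v), and_comm (a := u ∈ _)]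

/-- The number of `m`-subsets of `[n]` that contain a given set. -/
theorem card_superset_le {n : ℕ} (S : Finset (Fin n)) (m : ℕ) :
    (Finset.univ.filter fun e : Finset (Fin n) => S ⊆ e ∧ e.card = m).card ≤
      (n - S.card).choose (m - S.card) := by
  have : ((Finset.powersetCard (m - S.card) Sᶜ).card) = (n - S.card).choose (m - S.card) := by
    rw [Finset.card_powersetCard, Finset.card_compl, Fintype.card_fin]
  rw [← this]
  refine Finset.card_le_card_of_injOn (fun e => e \ S) ?_ ?_
  · intro e he
    simp only [Finset.coe_filter, Finset.mem_univ, true_and, Set.mem_ofPred_eq] at he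
    simp only [Finset.mem_coe, Finset.mem_powersetCard]
    refine ⟨fun x hx => ?_, ?_⟩
    · simp only [Finset.mem_compl]; exact (Finset.mem_sdiff.1 hx).2
    · rw [Finset.card_sdiff_of_subset he.1, he.2]
  · intro e he f hf hef
    simp only [Finset.coe_filter, Finset.mem_univ, true_and, Set.mem_ofPred_eq] at he hf
    dsimp only at hef
    rw [← Finset.sdiff_union_of_subset he.1, hef, Finset.sdiff_union_of_subset hf.1]

section Tensor

variable {n : ℕ} {Ω : Type*} [MeasurableSpace Ω] {P : Measure Ω} {𝓜 : Finset ℕ}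
  {Q : (m : ℕ) → (Fin m → Fin n) → ℝ} {H : Ω → Hypergraph n}

theorem IsErdosRenyi.card_mem_of_edgeProb_ne_zero (hH : IsErdosRenyi P 𝓜 Q H)
    {e : Finset (Fin n)} (he : edgeProb P H e ≠ 0) : e.card ∈ 𝓜 := by
  by_contra hcon
  apply he
  have : {ω | e ∈ H ω} = ∅ := by
    ext ω
    simpa using fun h => hcon (hH.card_mem ω e h)
  rw [edgeProb, this]
  simp

theorem IsErdosRenyi.choose_mul_edgeProb_le (hH : IsErdosRenyi P 𝓜 Q H)
    {e : Finset (Fin n)} (he : e.card ∈ 𝓜) :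
    ((n - 1).choose (e.card - 1) : ℝ) * edgeProb P H e ≤
      ⨆ i : Fin e.card → Fin n, ((n - 1).choose (e.card - 1) : ℝ) * Q e.card i := by
  have hinj : Function.Injective (e.orderEmbOfFin rfl) := (e.orderEmbOfFin rfl).injective
  have hp := hH.prob _ he (e.orderEmbOfFin rfl) hinj
  have himg : Finset.univ.image (e.orderEmbOfFin rfl) = e := by
    rw [← Finset.coe_inj, Finset.coe_image, Finset.coe_univ, Set.image_univ,
      Finset.range_orderEmbOfFin]
  rw [himg] at hp
  rw [edgeProb, hp]
  exact le_ciSup (f := fun i : Fin e.card → Fin n =>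
    ((n - 1).choose (e.card - 1) : ℝ) * Q e.card i) (Set.finite_range _).bddAbove _

theorem IsErdosRenyi.iSup_nonneg (hH : IsErdosRenyi P 𝓜 Q H) {m : ℕ} (hm : m ∈ 𝓜) :
    0 ≤ ⨆ i : Fin m → Fin n, ((n - 1).choose (m - 1) : ℝ) * Q m i :=
  Real.iSup_nonneg fun i => mul_nonneg (Nat.cast_nonneg _) (hH.tensor.nonneg m hm i)

theorem IsErdosRenyi.dMax_nonneg (hH : IsErdosRenyi P 𝓜 Q H) : 0 ≤ dMax 𝓜 Q :=
  Finset.sum_nonneg fun _ hm => hH.iSup_nonneg hm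

/-- For each size m there are at most (n-|S| choose m-|S|) relevant sets, each of probability at
most the m-th summand of d_max over (n-1 choose m-1); `a` and `b` bound the ratio of the binomials.
The hypothesis is free of division, so that it also forces the count to vanish when the denominator
does. -/
theorem IsErdosRenyi.sum_superset_edgeProb_le (hH : IsErdosRenyi P 𝓜 Q H) (S : Finset (Fin n))
    {a b : ℕ} (ha : 0 < a)
    (hab : ∀ m ∈ 𝓜, a * (n - S.card).choose (m - S.card) ≤ b * (n - 1).choose (m - 1)) :
    (a : ℝ) * ∑ e with S ⊆ e, edgeProb P H e ≤ b * dMax 𝓜 Q := by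
  classical
  have hsplit : ∑ e with S ⊆ e, edgeProb P H e =
      ∑ m ∈ 𝓜, ∑ e with S ⊆ e ∧ e.card = m, edgeProb P H e := by
    have h1 : ∑ e with S ⊆ e, edgeProb P H e =
        ∑ e ∈ (Finset.univ.filter fun e : Finset (Fin n) => S ⊆ e) with e.card ∈ 𝓜,
          edgeProb P H e := by
      refine (Finset.sum_filter_of_ne fun e _ he => hH.card_mem_of_edgeProb_ne_zero he).symm
    rw [h1, ← Finset.sum_fiberwise_of_maps_to (t := 𝓜) (g := Finset.card)
      (fun e he => (Finset.mem_filter.1 he).2)]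
    refine Finset.sum_congr rfl fun m hm => Finset.sum_congr ?_ fun _ _ => rfl
    ext e
    simp only [Finset.mem_filter, Finset.mem_univ, true_and]
    constructor
    · rintro ⟨⟨h1, -⟩, h3⟩; exact ⟨h1, h3⟩
    · rintro ⟨h1, rfl⟩; exact ⟨⟨h1, hm⟩, rfl⟩
  rw [hsplit, dMax, Finset.mul_sum, Finset.mul_sum]
  refine Finset.sum_le_sum fun m hm => ?_
  set D := ⨆ i : Fin m → Fin n, ((n - 1).choose (m - 1) : ℝ) * Q m i
  have hD : 0 ≤ D := hH.iSup_nonneg hm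
  set F := Finset.univ.filter fun e : Finset (Fin n) => S ⊆ e ∧ e.card = m with hF
  have hcard : a * F.card ≤ b * (n - 1).choose (m - 1) :=
    (Nat.mul_le_mul_left a (card_superset_le S m)).trans (hab m hm)
  rcases Nat.eq_zero_or_pos ((n - 1).choose (m - 1)) with h0 | hpos
  · have hF0 : F = ∅ := by
      rw [h0, mul_zero] at hcard
      rw [← Finset.card_eq_zero]
      rcases Nat.mul_eq_zero.1 (Nat.le_zero.1 hcard) with h | h
      · omega
      · exact h
    rw [hF0]
    simp only [Finset.sum_empty, mul_zero]
    positivity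
  · have hposR : (0 : ℝ) < ((n - 1).choose (m - 1) : ℝ) := by exact_mod_cast hpos
    have hbound : ∀ e ∈ F, edgeProb P H e ≤ D / ((n - 1).choose (m - 1) : ℝ) := by
      intro e he
      obtain ⟨-, -, rfl⟩ := Finset.mem_filter.1 he
      rw [le_div_iff₀ hposR, mul_comm]
      exact hH.choose_mul_edgeProb_le hm
    have hcardR : (a : ℝ) * F.card ≤ b * ((n - 1).choose (m - 1) : ℝ) := by exact_mod_cast hcard
    calc (a : ℝ) * ∑ e ∈ F, edgeProb P H e
        ≤ a * (F.card * (D / ((n - 1).choose (m - 1) : ℝ))) := by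
          refine mul_le_mul_of_nonneg_left ?_ (Nat.cast_nonneg _)
          simpa using Finset.sum_le_card_nsmul F _ _ hbound
      _ = a * F.card * (D / ((n - 1).choose (m - 1) : ℝ)) := by ring
      _ ≤ b * ((n - 1).choose (m - 1) : ℝ) * (D / ((n - 1).choose (m - 1) : ℝ)) := by gcongr
      _ = b * D := by field_simp

/-- The expected degree is at most `d_max`. -/
theorem IsErdosRenyi.sum_mem_edgeProb_le (hH : IsErdosRenyi P 𝓜 Q H) (v : Fin n) :
    ∑ e with v ∈ e, edgeProb P H e ≤ dMax 𝓜 Q := by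
  have := hH.sum_superset_edgeProb_le {v} (a := 1) (b := 1) one_pos (by simp)
  simpa using this

/-- The expected number of hyperedges containing two given vertices. -/
theorem IsErdosRenyi.sum_pair_edgeProb_le (hH : IsErdosRenyi P 𝓜 Q H) {M : ℕ}
    (hM : ∀ m ∈ 𝓜, m ≤ M) (h2 : ∀ m ∈ 𝓜, 2 ≤ m) {u v : Fin n} (huv : u ≠ v) :
    ∑ e with u ∈ e ∧ v ∈ e, edgeProb P H e ≤ 2 * (M - 1 : ℝ) * dMax 𝓜 Q / n := by
  have hn : 2 ≤ n := by
    by_contra hcon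
    apply huv
    ext
    omega
  have hcard : ({u, v} : Finset (Fin n)).card = 2 := Finset.card_pair huv
  -- The ratio comes from (n-1)(n-2 choose m-2) = (m-1)(n-1 choose m-1). The factor 2 in the claim
  -- replaces 1/(n-1) by 2/n.
  have h := hH.sum_superset_edgeProb_le {u, v} (a := n - 1) (b := M - 1) (by omega) (by
    intro m hm
    rw [hcard]
    obtain ⟨k, rfl⟩ := Nat.exists_eq_add_of_le (h2 m hm)
    obtain ⟨j, rfl⟩ := Nat.exists_eq_add_of_le hn
    have e1 : 2 + j - 1 = j + 1 := by omega
    have e2 : 2 + j - 2 = j := by omega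
    have e3 : 2 + k - 1 = k + 1 := by omega
    have e4 : 2 + k - 2 = k := by omega
    rw [e1, e2, e3, e4, Nat.add_one_mul_choose_eq, mul_comm]
    have := hM _ hm
    exact Nat.mul_le_mul_right _ (by omega))
  have hset : (Finset.univ.filter fun e : Finset (Fin n) => ({u, v} : Finset (Fin n)) ⊆ e) =
      Finset.univ.filter fun e => u ∈ e ∧ v ∈ e := by
    ext e
    simp [Finset.insert_subset_iff]
  rw [hset] at h
  set X := ∑ e with u ∈ e ∧ v ∈ e, edgeProb P H e
  have hX : 0 ≤ X := Finset.sum_nonneg fun e _ => edgeProb_nonneg e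
  rcases 𝓜.eq_empty_or_nonempty with h0 | ⟨m, hm⟩
  · have hX0 : X = 0 := Finset.sum_eq_zero fun e _ => by
      by_contra hne
      simpa [h0] using hH.card_mem_of_edgeProb_ne_zero hne
    rw [hX0, h0]
    simp [dMax]
  have hM1 : 1 ≤ M := by have := hM m hm; have := h2 m hm; omega
  rw [Nat.cast_sub (by omega), Nat.cast_sub hM1, Nat.cast_one] at h
  have hnR : (2 : ℝ) ≤ n := by exact_mod_cast hn
  rw [le_div_iff₀ (by linarith)]
  nlinarith

variable [IsProbabilityMeasure P]

theorem IsErdosRenyi.meanAdjMatrix_apply (hH : IsErdosRenyi P 𝓜 Q H) (u v : Fin n) :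
    meanAdjMatrix P H u v =
      ∑ e, (if u ≠ v ∧ u ∈ e ∧ v ∈ e then 1 else 0) * edgeProb P H e := by
  simp only [meanAdjMatrix, Matrix.of_apply, adjMatrix_eq_edgeSum]
  exact integral_edgeSum hH.measurableSet _

theorem IsErdosRenyi.meanAdjMatrix_nonneg (hH : IsErdosRenyi P 𝓜 Q H) (u v : Fin n) :
    0 ≤ meanAdjMatrix P H u v := by
  rw [hH.meanAdjMatrix_apply]
  exact Finset.sum_nonneg fun e _ => mul_nonneg (by positivity) (edgeProb_nonneg e)

theorem IsErdosRenyi.meanAdjMatrix_le (hH : IsErdosRenyi P 𝓜 Q H) {M : ℕ}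
    (hM : ∀ m ∈ 𝓜, m ≤ M) (hM1 : 1 ≤ M) (h2 : ∀ m ∈ 𝓜, 2 ≤ m) (u v : Fin n) :
    meanAdjMatrix P H u v ≤ 2 * (M - 1 : ℝ) * dMax 𝓜 Q / n := by
  rw [hH.meanAdjMatrix_apply]
  by_cases huv : u = v
  · have hM1' : (1 : ℝ) ≤ M := by exact_mod_cast hM1
    simp only [huv, ne_eq, not_true_eq_false, false_and, if_false, zero_mul,
      Finset.sum_const_zero]
    have := hH.dMax_nonneg
    have : (0 : ℝ) ≤ M - 1 := by linarith
    positivity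
  · refine le_trans (le_of_eq ?_) (hH.sum_pair_edgeProb_le hM h2 huv)
    rw [Finset.sum_filter]
    refine Finset.sum_congr rfl fun e _ => ?_
    by_cases he : u ∈ e ∧ v ∈ e <;> simp [huv, he]

end Tensor

/-- Row sums of the adjacency matrix are controlled by the degrees. -/
theorem sum_adjMatrix_le {n : ℕ} {h : Hypergraph n} {M : ℕ} (hM : ∀ e ∈ h, e.card ≤ M)
    (u : Fin n) : ∑ v, adjMatrix h u v ≤ (M - 1 : ℝ) * degree h u := by
  simp only [adjMatrix_eq_edgeSum, degree_eq_edgeSum, edgeSum]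
  rw [Finset.sum_comm, Finset.mul_sum]
  refine Finset.sum_le_sum fun e he => ?_
  by_cases hu : u ∈ e
  · have : ∑ v, (if u ≠ v ∧ u ∈ e ∧ v ∈ e then (1 : ℝ) else 0) = ((e.erase u).card : ℝ) := by
      rw [← Finset.sum_filter, Finset.sum_const, nsmul_eq_mul, mul_one]
      congr 2
      ext v
      simp [hu, ne_comm]
    rw [this, Finset.card_erase_of_mem hu, if_pos hu, mul_one,
      Nat.cast_sub (Finset.card_pos.2 ⟨u, hu⟩)]
    have : (e.card : ℝ) ≤ M := by exact_mod_cast hM e he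
    simpa using this
  · simp [hu]

/-! ### Deterministic sums over dyadic levels -/

/-- A geometric sum over integers bounded above is controlled by its largest term. -/
theorem sum_zpow_le {r X : ℝ} (hr : 1 < r) (hX : 0 ≤ X) (F : Finset ℤ)
    (hF : ∀ s ∈ F, r ^ s ≤ X) : ∑ s ∈ F, r ^ s ≤ X * (r / (r - 1)) := by
  have hr0 : 0 < r := by linarith
  have hr1 : 0 < r - 1 := by linarith
  induction F using Finset.induction_on_max generalizing X with
  | empty => simpa using by positivity
  | insert a F ha ih =>
    rw [Finset.sum_insert (fun h => lt_irrefl _ (ha a h))]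
    -- Exponents below the maximum `a` are at most `a - 1`, and r^a + r^(a-1) · r/(r-1) = r^a ·
    -- r/(r-1).
    have h1 : ∑ s ∈ F, r ^ s ≤ r ^ (a - 1) * (r / (r - 1)) := by
      refine ih (by positivity) fun s hs => ?_
      have := ha s hs
      exact zpow_le_zpow_right₀ hr.le (by omega)
    have h2 : r ^ (a - 1) = r ^ a / r := by rw [zpow_sub_one₀ hr0.ne']; rfl
    have h3 : r ^ a + r ^ (a - 1) * (r / (r - 1)) = r ^ a * (r / (r - 1)) := by
      rw [h2]; field_simp; ring
    have h4 : r ^ a * (r / (r - 1)) ≤ X * (r / (r - 1)) := by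
      have := hF a (Finset.mem_insert_self _ _)
      gcongr
    linarith

theorem sum_two_zpow_le {X : ℝ} (hX : 0 ≤ X) (F : Finset ℤ)
    (hF : ∀ s ∈ F, (2 : ℝ) ^ s ≤ X) : ∑ s ∈ F, (2 : ℝ) ^ s ≤ 2 * X := by
  have := sum_zpow_le one_lt_two hX F hF
  norm_num at this
  linarith

theorem sum_zpow_neg_le {r X : ℝ} (hr : 1 < r) (hX : 0 ≤ X) (F : Finset ℤ)
    (hF : ∀ s ∈ F, r ^ (-s) ≤ X) : ∑ s ∈ F, r ^ (-s) ≤ X * (r / (r - 1)) := by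
  have := sum_zpow_le hr hX (F.image Neg.neg) (by simpa using hF)
  rwa [Finset.sum_image (fun a _ b _ h => neg_injective h)] at this

/-- If a positive quantity `z ≤ 1` satisfies `4 ^ t * z ≤ 4` for each `t`, then the sums of
`2 ^ t * z * (e / z) ^ (1 / 4)` are bounded. -/
theorem sum_level_weight_le (T : Finset ℤ) (z : ℤ → ℝ) (hz0 : ∀ t ∈ T, 0 < z t)
    (hz1 : ∀ t ∈ T, z t ≤ 1) (hz : ∀ t ∈ T, 4 ^ t * z t ≤ 4) :
    ∑ t ∈ T, 2 ^ t * z t * Real.exp (Real.log (Real.exp 1 / z t) / 4) ≤ 12 := by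
  set ω : ℝ := √2 with hω
  have hω2 : ω ^ 2 = 2 := Real.sq_sqrt (by norm_num)
  have hω1 : 1.414 ≤ ω := Real.le_sqrt_of_sq_le (by norm_num)
  have hω0 : 0 < ω := by linarith
  have he : Real.exp (1 / 4) ≤ 1.3 := by
    have h1 : Real.exp (1 / 4) ^ 4 = Real.exp 1 := by rw [← Real.exp_nat_mul]; norm_num
    have h2 := Real.exp_one_lt_d9
    by_contra! hcon
    have : (1.3 : ℝ) ^ 4 ≤ Real.exp (1 / 4) ^ 4 := by gcongr
    rw [h1] at this
    norm_num at this h2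
    linarith
  -- Since z (e/z)^(1/4) = e^(1/4) z^(3/4), a bound z ≤ y^4 yields e^(1/4) y^3. Below, y = 1 for t ≤
  -- 1 and y = √2^(1-t) for larger t, so both ranges are geometric.
  have key : ∀ t ∈ T, ∀ y : ℝ, 0 < y → z t ≤ y ^ 4 →
      2 ^ t * z t * Real.exp (Real.log (Real.exp 1 / z t) / 4) ≤ 1.3 * (2 ^ t * y ^ 3) := by
    intro t ht y hy hzy
    have hzt := hz0 t ht
    set r := Real.exp (Real.log (Real.exp 1 / z t) / 4) with hr
    have hr0 : 0 < r := Real.exp_pos _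
    have hr4 : r ^ 4 = Real.exp 1 / z t := by
      rw [hr, ← Real.exp_nat_mul]
      rw [show ((4 : ℕ) : ℝ) * (Real.log (Real.exp 1 / z t) / 4) = Real.log (Real.exp 1 / z t) by
        push_cast; ring, Real.exp_log (by positivity)]
    have hzr : z t * r ^ 4 = Real.exp (1 / 4) ^ 4 := by
      rw [hr4, ← Real.exp_nat_mul]; field_simp; norm_num
    have hry : Real.exp (1 / 4) ≤ r * y := by
      refine le_of_pow_le_pow_left₀ (n := 4) (by norm_num) (by positivity) ?_
      rw [← hzr, mul_pow, mul_comm]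
      gcongr
    have h3 : z t * r ≤ Real.exp (1 / 4) * y ^ 3 := by
      have h5 : z t * r * r ^ 3 ≤ Real.exp (1 / 4) * y ^ 3 * r ^ 3 := by
        calc z t * r * r ^ 3 = Real.exp (1 / 4) * Real.exp (1 / 4) ^ 3 := by
              rw [← pow_succ', ← hzr]; ring
          _ ≤ Real.exp (1 / 4) * (r * y) ^ 3 := by gcongr
          _ = _ := by ring
      exact le_of_mul_le_mul_right h5 (by positivity)
    calc 2 ^ t * z t * r = 2 ^ t * (z t * r) := by ring
      _ ≤ 2 ^ t * (Real.exp (1 / 4) * y ^ 3) := by gcongr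
      _ ≤ 2 ^ t * (1.3 * y ^ 3) := by gcongr
      _ = _ := by ring
  have hsmall : ∑ t ∈ T with t ≤ 1, 2 ^ t * z t * Real.exp (Real.log (Real.exp 1 / z t) / 4) ≤
      1.3 * 4 := by
    have h1 := sum_two_zpow_le (X := 2) (by norm_num) (T.filter fun t => t ≤ 1) (by
      intro s hs
      have := zpow_le_zpow_right₀ (one_le_two (α := ℝ)) (Finset.mem_filter.1 hs).2
      simpa using this)
    refine (Finset.sum_le_sum fun t ht => ?_).trans
      ((Finset.mul_sum _ _ (1.3 : ℝ)).symm.le.trans (mul_le_mul_of_nonneg_left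
        (h1.trans (by norm_num)) (by norm_num)))
    have ht' := (Finset.mem_filter.1 ht).1
    simpa using key t ht' 1 one_pos (by simpa using hz1 t ht')
  have hlarge : ∑ t ∈ T with ¬ t ≤ 1,
      2 ^ t * z t * Real.exp (Real.log (Real.exp 1 / z t) / 4) ≤ 1.3 * 5 := by
    have h1 := sum_zpow_neg_le (r := ω) (X := ω ^ (-2 : ℤ)) (by linarith) (by positivity)
      (T.filter fun t => ¬ t ≤ 1) (by
      intro s hs
      have := (Finset.mem_filter.1 hs).2
      exact zpow_le_zpow_right₀ (by linarith) (by omega))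
    have h2 : ω ^ 3 * (ω ^ (-2 : ℤ) * (ω / (ω - 1))) ≤ 5 := by
      have hω2' : ω ^ (-2 : ℤ) = (2 : ℝ)⁻¹ := by
        rw [zpow_neg, show (2 : ℤ) = ((2 : ℕ) : ℤ) from rfl, zpow_natCast, hω2]
      have hne : ω - 1 ≠ 0 := by linarith
      rw [hω2', show ω ^ 3 * (2⁻¹ * (ω / (ω - 1))) = (ω ^ 2) ^ 2 / (2 * (ω - 1)) by field_simp, hω2,
        div_le_iff₀ (by linarith)]
      linarith
    refine (Finset.sum_le_sum (g := fun t => 1.3 * (ω ^ 3 * ω ^ (-t))) fun t ht => ?_).trans ?_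
    · have ht' := (Finset.mem_filter.1 ht).1
      have h4 : (4 : ℝ) ^ t = (ω ^ t) ^ 4 := by
        rw [← zpow_natCast, ← zpow_mul, mul_comm, zpow_mul, zpow_natCast]
        rw [show ω ^ 4 = (ω ^ 2) ^ 2 by ring, hω2]; norm_num
      have h2t : (2 : ℝ) ^ t = (ω ^ t) ^ 2 := by
        rw [← zpow_natCast, ← zpow_mul, mul_comm, zpow_mul, zpow_natCast, hω2]
      have hp : 0 < ω ^ t := by positivity
      have := key t ht' (ω * ω ^ (-t)) (by positivity) (by
        have h5 := hz t ht'
        rw [h4] at h5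
        rw [zpow_neg, ← div_eq_mul_inv, div_pow, le_div_iff₀ (by positivity), mul_comm,
          show ω ^ 4 = (ω ^ 2) ^ 2 by ring, hω2]
        linarith)
      refine this.trans (le_of_eq ?_)
      rw [h2t, zpow_neg]
      field_simp
    · rw [← Finset.mul_sum, ← Finset.mul_sum]
      refine mul_le_mul_of_nonneg_left (le_trans ?_ h2) (by norm_num)
      gcongr
  rw [← Finset.sum_filter_add_sum_filter_not T fun t => t ≤ 1]
  linarith

/-- The level sums of the pairs of levels whose edge count is controlled by the entropy of the
second level. -/
theorem sum_entropy_levels_le (S T : Finset ℤ) (μ ν : ℤ → ℝ) (E : ℤ → ℤ → ℝ)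
    {N δ κ c g : ℝ} (hN : 0 < N) (hδ : 0 < δ) (hκ : 0 ≤ κ) (hc : 0 ≤ c) (hg : 0 < g)
    (hμ0 : ∀ s ∈ S, 0 < μ s) (hν0 : ∀ t ∈ T, 0 < ν t) (hνN : ∀ t ∈ T, ν t ≤ N)
    (hμ : ∑ s ∈ S, 4 ^ s * μ s ≤ 4 * N) (hν : ∑ t ∈ T, 4 ^ t * ν t ≤ 4 * N)
    (hE0 : ∀ s t, 0 ≤ E s t) (hEdeg : ∀ s ∈ S, ∀ t ∈ T, E s t ≤ κ * δ ^ 2 * μ s)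
    (R : Finset (ℤ × ℤ)) (hRS : R ⊆ S ×ˢ T)
    (hR1 : ∀ p ∈ R, Real.exp 2 * (g * δ ^ 2 / N * μ p.1 * ν p.2) < E p.1 p.2)
    (hR2 : ∀ p ∈ R, E p.1 p.2 * Real.log (E p.1 p.2 / (g * δ ^ 2 / N * μ p.1 * ν p.2)) ≤
      c * (ν p.2 * Real.log (Real.exp 1 * N / ν p.2))) :
    ∑ p ∈ R, 2 ^ p.1 * 2 ^ p.2 * E p.1 p.2 ≤ (8 * κ + 50 * c + 48 * g) * (δ * N) := by
  set L : ℤ → ℝ := fun t => Real.log (Real.exp 1 * N / ν t) with hL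
  set r : ℤ → ℝ := fun t => Real.exp (L t / 4) with hr
  have hr0 : ∀ t, 0 < r t := fun t => Real.exp_pos _
  have hL0 : ∀ t ∈ T, 0 ≤ L t := fun t ht => by
    refine Real.log_nonneg ?_
    rw [one_le_div (hν0 t ht)]
    have := hνN t ht
    have := Real.add_one_le_exp (1 : ℝ)
    nlinarith
  -- From e·x ≤ e^x at x = L/4, as 4/e < 1.5.
  have hLr : ∀ t, L t ≤ 1.5 * r t := fun t => by
    have h1 := Real.add_one_le_exp (L t / 4 - 1)
    rw [Real.exp_sub, le_div_iff₀ (Real.exp_pos 1)] at h1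
    have h2 := Real.exp_one_gt_d9
    have h3 : r t = Real.exp (L t / 4) := rfl
    rw [← h3] at h1
    have h4 := hr0 t
    by_cases h5 : 0 ≤ L t
    · nlinarith
    · nlinarith
  have hY : ∑ t ∈ T, 2 ^ t * ν t * r t ≤ 12 * N := by
    have h1 := sum_level_weight_le T (fun t => ν t / N) (fun t ht => div_pos (hν0 t ht) hN)
      (fun t ht => (div_le_one hN).2 (hνN t ht)) (fun t ht => by
        rw [← mul_div_assoc, div_le_iff₀ hN]
        exact (Finset.single_le_sum (f := fun t => 4 ^ t * ν t)
          (fun i hi => by have := hν0 i hi; positivity) ht).trans hν)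
    have h2 : ∑ t ∈ T, 2 ^ t * ν t * r t = N * ∑ t ∈ T, 2 ^ t * (ν t / N) *
        Real.exp (Real.log (Real.exp 1 / (ν t / N)) / 4) := by
      rw [Finset.mul_sum]
      refine Finset.sum_congr rfl fun t _ => ?_
      simp only [hr, hL, div_div_eq_mul_div]
      field_simp
    rw [h2]
    nlinarith
  -- Four majorants, one of which bounds each pair; q is the mean bound gδ²μν/N and X the block sum.
  -- A: 2^t ≤ 2^s/δ; use the degree bound and sum over t. B: otherwise 2^s < δ2^t; if L ≤ 4
  -- log(X/q), the entropy bound gives X ≤ 4cν; sum over s. D: L > 4 log(X/q) and 2^s ≤ δ; as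
  -- log(X/q) ≥ 2, X ≤ (c/2)νL; sum over s. C: L > 4 log(X/q) and 2^s > δ; X ≤ rq, and trading one δ
  -- for 2^s makes the double sum factorise. B and D contribute 32c + 18c = 50c.
  set fA : ℤ × ℤ → ℝ := fun p =>
    if 2 ^ p.2 ≤ (2 : ℝ) ^ p.1 / δ then 2 ^ p.1 * (κ * δ ^ 2 * μ p.1) * 2 ^ p.2 else 0 with hfA
  set fB : ℤ × ℤ → ℝ := fun p =>
    if 2 ^ p.1 ≤ δ * (2 : ℝ) ^ p.2 then 2 ^ p.2 * (4 * c * ν p.2) * 2 ^ p.1 else 0 with hfB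
  set fC : ℤ × ℤ → ℝ := fun p =>
    4 ^ p.1 * μ p.1 * (g * δ / N * (2 ^ p.2 * ν p.2 * r p.2)) with hfC
  set fD : ℤ × ℤ → ℝ := fun p =>
    if 2 ^ p.1 ≤ δ then c / 2 * (2 ^ p.2 * ν p.2 * L p.2) * 2 ^ p.1 else 0 with hfD
  have hA0 : ∀ p ∈ S ×ˢ T, 0 ≤ fA p := fun p hp => by
    have := hμ0 p.1 (Finset.mem_product.1 hp).1
    simp only [hfA]; positivity
  have hB0 : ∀ p ∈ S ×ˢ T, 0 ≤ fB p := fun p hp => by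
    have := hν0 p.2 (Finset.mem_product.1 hp).2
    simp only [hfB]; positivity
  have hC0 : ∀ p ∈ S ×ˢ T, 0 ≤ fC p := fun p hp => by
    have := hμ0 p.1 (Finset.mem_product.1 hp).1
    have := hν0 p.2 (Finset.mem_product.1 hp).2
    have := hr0 p.2
    simp only [hfC]; positivity
  have hD0 : ∀ p ∈ S ×ˢ T, 0 ≤ fD p := fun p hp => by
    have := hν0 p.2 (Finset.mem_product.1 hp).2
    have := hL0 p.2 (Finset.mem_product.1 hp).2
    simp only [hfD]; positivity
  have hpt : ∀ p ∈ R, 2 ^ p.1 * 2 ^ p.2 * E p.1 p.2 ≤ fA p + fB p + fC p + fD p := by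
    rintro ⟨s, t⟩ hp
    have hpST := hRS hp
    obtain ⟨hs, ht⟩ := Finset.mem_product.1 hpST
    have a0 := hA0 _ hpST
    have b0 := hB0 _ hpST
    have c0 := hC0 _ hpST
    have d0 := hD0 _ hpST
    have h1 := hR1 _ hp
    have h2 := hR2 _ hp
    have hμs := hμ0 s hs
    have hνt := hν0 t ht
    simp only at hs ht h1 h2
    have hE := hE0 s t
    set X := E s t with hX
    set q := g * δ ^ 2 / N * μ s * ν t with hq
    have hq0 : 0 < q := by positivity
    have hlog : 2 ≤ Real.log (X / q) := by
      rw [Real.le_log_iff_exp_le (by have := Real.exp_pos 2; exact div_pos (by nlinarith) hq0),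
        le_div_iff₀ hq0]
      exact h1.le
    have p2s : (0 : ℝ) < 2 ^ s := by positivity
    have p2t : (0 : ℝ) < 2 ^ t := by positivity
    have hXpos : 0 < X := lt_trans (by have := Real.exp_pos 2; positivity) h1
    change c * (ν t * L t) ≥ _ at h2
    by_cases hdeg : 2 ^ t ≤ (2 : ℝ) ^ s / δ
    · have : 2 ^ s * 2 ^ t * X ≤ fA (s, t) := by
        simp only [hfA, if_pos hdeg]
        have := hEdeg s hs t ht
        calc 2 ^ s * 2 ^ t * X ≤ 2 ^ s * 2 ^ t * (κ * δ ^ 2 * μ s) := by gcongr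
          _ = _ := by ring
      linarith
    rw [not_le, div_lt_iff₀ hδ, mul_comm] at hdeg
    by_cases hq4 : L t ≤ 4 * Real.log (X / q)
    · have : 2 ^ s * 2 ^ t * X ≤ fB (s, t) := by
        simp only [hfB, if_pos hdeg.le]
        have h3 : X * Real.log (X / q) ≤ 4 * c * ν t * Real.log (X / q) := by
          calc _ ≤ c * (ν t * L t) := h2
            _ ≤ c * (ν t * (4 * Real.log (X / q))) := by gcongr
            _ = _ := by ring
        have h4 : X ≤ 4 * c * ν t := le_of_mul_le_mul_right h3 (by linarith)
        calc 2 ^ s * 2 ^ t * X ≤ 2 ^ s * 2 ^ t * (4 * c * ν t) := by gcongr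
          _ = _ := by ring
      linarith
    rw [not_le] at hq4
    by_cases hsδ : (2 : ℝ) ^ s ≤ δ
    · have : 2 ^ s * 2 ^ t * X ≤ fD (s, t) := by
        simp only [hfD, if_pos hsδ]
        have h4 : X ≤ c / 2 * (ν t * L t) := by nlinarith
        calc 2 ^ s * 2 ^ t * X ≤ 2 ^ s * 2 ^ t * (c / 2 * (ν t * L t)) := by gcongr
          _ = _ := by ring
      linarith
    · have : 2 ^ s * 2 ^ t * X ≤ fC (s, t) := by
        have h3 : X / q ≤ r t := by
          rw [← Real.exp_log (div_pos hXpos hq0)]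
          exact Real.exp_le_exp.2 (by linarith)
        rw [div_le_iff₀ hq0] at h3
        have h4 : (4 : ℝ) ^ s = 2 ^ s * 2 ^ s := by
          rw [← mul_zpow]; norm_num
        have hrt := hr0 t
        have hsδ' : δ ≤ 2 ^ s := (not_le.1 hsδ).le
        simp only [hfC]
        calc 2 ^ s * 2 ^ t * X ≤ 2 ^ s * 2 ^ t * (r t * q) := by gcongr
          _ = δ * (2 ^ s * μ s * (g * δ / N * (2 ^ t * ν t * r t))) := by rw [hq]; ring
          _ ≤ 2 ^ s * (2 ^ s * μ s * (g * δ / N * (2 ^ t * ν t * r t))) := by gcongr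
          _ = _ := by rw [h4]; ring
      linarith
  have hA : ∑ p ∈ S ×ˢ T, fA p ≤ 8 * κ * (δ * N) := by
    rw [Finset.sum_product]
    calc ∑ s ∈ S, ∑ t ∈ T, fA (s, t) ≤ ∑ s ∈ S, 2 * κ * δ * (4 ^ s * μ s) := by
          refine Finset.sum_le_sum fun s hs => ?_
          have hμs := hμ0 s hs
          simp only [hfA]
          rw [← Finset.sum_filter, ← Finset.mul_sum]
          have h1 := sum_two_zpow_le (X := 2 ^ s / δ) (by positivity)
            (T.filter fun t => (2 : ℝ) ^ t ≤ 2 ^ s / δ) fun t ht => (Finset.mem_filter.1 ht).2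
          have h4 : (4 : ℝ) ^ s = 2 ^ s * 2 ^ s := by
            rw [← mul_zpow]; norm_num
          calc _ ≤ 2 ^ s * (κ * δ ^ 2 * μ s) * (2 * (2 ^ s / δ)) := by gcongr
            _ = _ := by rw [h4]; field_simp
      _ ≤ 2 * κ * δ * (4 * N) := by rw [← Finset.mul_sum]; gcongr
      _ = _ := by ring
  have hB : ∑ p ∈ S ×ˢ T, fB p ≤ 32 * c * (δ * N) := by
    rw [Finset.sum_product_right]
    calc ∑ t ∈ T, ∑ s ∈ S, fB (s, t) ≤ ∑ t ∈ T, 8 * c * δ * (4 ^ t * ν t) := by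
          refine Finset.sum_le_sum fun t ht => ?_
          have hνt := hν0 t ht
          simp only [hfB]
          rw [← Finset.sum_filter, ← Finset.mul_sum]
          have h1 := sum_two_zpow_le (X := δ * 2 ^ t) (by positivity)
            (S.filter fun s => (2 : ℝ) ^ s ≤ δ * 2 ^ t) fun s hs => (Finset.mem_filter.1 hs).2
          have h4 : (4 : ℝ) ^ t = 2 ^ t * 2 ^ t := by
            rw [← mul_zpow]; norm_num
          calc _ ≤ 2 ^ t * (4 * c * ν t) * (2 * (δ * 2 ^ t)) := by gcongr
            _ = _ := by rw [h4]; ring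
      _ ≤ 8 * c * δ * (4 * N) := by rw [← Finset.mul_sum]; gcongr
      _ = _ := by ring
  have hC : ∑ p ∈ S ×ˢ T, fC p ≤ 48 * g * (δ * N) := by
    rw [Finset.sum_product]
    simp only [hfC]
    simp_rw [← Finset.mul_sum]
    rw [← Finset.sum_mul]
    have h0 : 0 ≤ ∑ t ∈ T, 2 ^ t * ν t * r t := Finset.sum_nonneg fun t ht => by
      have := hν0 t ht; have := hr0 t; positivity
    calc _ ≤ 4 * N * (g * δ / N * (12 * N)) := by gcongr
      _ = _ := by field_simp; ring
  have hD : ∑ p ∈ S ×ˢ T, fD p ≤ 18 * c * (δ * N) := by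
    rw [Finset.sum_product_right]
    calc ∑ t ∈ T, ∑ s ∈ S, fD (s, t) ≤ ∑ t ∈ T, 1.5 * c * δ * (2 ^ t * ν t * r t) := by
          refine Finset.sum_le_sum fun t ht => ?_
          have hνt := hν0 t ht
          have hLt := hL0 t ht
          simp only [hfD]
          rw [← Finset.sum_filter, ← Finset.mul_sum]
          have h1 := sum_two_zpow_le (X := δ) hδ.le
            (S.filter fun s => (2 : ℝ) ^ s ≤ δ) fun s hs => (Finset.mem_filter.1 hs).2
          calc _ ≤ c / 2 * (2 ^ t * ν t * L t) * (2 * δ) := by gcongr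
            _ ≤ c / 2 * (2 ^ t * ν t * (1.5 * r t)) * (2 * δ) := by gcongr; exact hLr t
            _ = _ := by ring
      _ ≤ 1.5 * c * δ * (12 * N) := by rw [← Finset.mul_sum]; gcongr
      _ = _ := by ring
  calc ∑ p ∈ R, 2 ^ p.1 * 2 ^ p.2 * E p.1 p.2
      ≤ ∑ p ∈ R, (fA p + fB p + fC p + fD p) := Finset.sum_le_sum hpt
    _ ≤ ∑ p ∈ S ×ˢ T, (fA p + fB p + fC p + fD p) :=
        Finset.sum_le_sum_of_subset_of_nonneg hRS fun p hp _ => by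
          linarith [hA0 p hp, hB0 p hp, hC0 p hp, hD0 p hp]
    _ = ∑ p ∈ S ×ˢ T, fA p + ∑ p ∈ S ×ˢ T, fB p + ∑ p ∈ S ×ˢ T, fC p + ∑ p ∈ S ×ˢ T, fD p := by
        simp only [Finset.sum_add_distrib]
    _ ≤ _ := by linarith

/-! ### Discrepancy, level sets and the heavy pairs -/

/-- The entropy weight of a vertex set. -/
noncomputable def entropyWeight {n : ℕ} (S : Finset (Fin n)) : ℝ :=
  S.card * Real.log (Real.exp 1 * n / S.card)

/-- The total weight of a matrix between two vertex sets. -/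
def blockSum {n : ℕ} (A : Fin n → Fin n → ℝ) (S T : Finset (Fin n)) : ℝ :=
  ∑ u ∈ S, ∑ v ∈ T, A u v

/-- The discrepancy property of Feige and Ofek: each block sum is either comparable to `q |S| |T|`,
or controlled by the entropy of one of the two vertex sets. -/
def BoundedDiscrepancy {n : ℕ} (A : Fin n → Fin n → ℝ) (q c : ℝ) : Prop :=
  ∀ S T : Finset (Fin n), S.Nonempty → T.Nonempty →
    blockSum A S T ≤ Real.exp 2 * (q * S.card * T.card) ∨
    blockSum A S T * Real.log (blockSum A S T / (q * S.card * T.card)) ≤ c * entropyWeight S ∨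
    blockSum A S T * Real.log (blockSum A S T / (q * S.card * T.card)) ≤ c * entropyWeight T

/-- The dyadic level of a coordinate of a vector, relative to the scale `1 / √n`. -/
noncomputable def level {n : ℕ} (x : Fin n → ℝ) (u : Fin n) : ℤ := Int.clog 2 (|x u| * √n)

/-- The coordinates of a given dyadic level. -/
noncomputable def levelSet {n : ℕ} (x : Fin n → ℝ) (s : ℤ) : Finset (Fin n) :=
  Finset.univ.filter fun u => x u ≠ 0 ∧ level x u = s

/-- The dyadic levels that occur. -/
noncomputable def levels {n : ℕ} (x : Fin n → ℝ) : Finset ℤ :=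
  (Finset.univ.filter fun u => x u ≠ 0).image (level x)

section Levels

variable {n : ℕ} {x : Fin n → ℝ}

theorem levelSet_nonempty {s : ℤ} (hs : s ∈ levels x) : (levelSet x s).Nonempty := by
  obtain ⟨u, hu, rfl⟩ := Finset.mem_image.1 hs
  exact ⟨u, by simpa [levelSet] using hu⟩

theorem ne_zero_of_mem_levelSet {s : ℤ} {u : Fin n} (hu : u ∈ levelSet x s) : x u ≠ 0 :=
  (Finset.mem_filter.1 hu).2.1

theorem mem_levelSet_level {u : Fin n} (hu : x u ≠ 0) : u ∈ levelSet x (level x u) := by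
  simp [levelSet, hu]

theorem level_mem_levels {u : Fin n} (hu : x u ≠ 0) : level x u ∈ levels x :=
  Finset.mem_image_of_mem _ (by simpa using hu)

theorem abs_mul_sqrt_le_two_zpow_level (u : Fin n) : |x u| * √n ≤ 2 ^ level x u := by
  exact_mod_cast Int.self_le_zpow_clog (R := ℝ) one_lt_two (|x u| * √n)

theorem four_zpow_level_le {u : Fin n} (hu : x u ≠ 0) :
    (4 : ℝ) ^ level x u ≤ 4 * n * x u ^ 2 := by
  have hn : (0 : ℝ) < n := by exact_mod_cast u.pos
  have hpos : 0 < |x u| * √n := by positivity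
  have h := Int.zpow_pred_clog_lt_self (R := ℝ) one_lt_two hpos
  have h2 : (2 : ℝ) ^ (level x u - 1) ≤ |x u| * √n := by simpa [level] using h.le
  have h4 : (4 : ℝ) ^ level x u = 4 * (2 ^ (level x u - 1)) ^ 2 := by
    rw [zpow_sub_one₀ two_ne_zero, mul_pow, ← zpow_natCast, ← zpow_mul, mul_comm (level x u),
      zpow_mul]
    norm_num
    ring
  calc (4 : ℝ) ^ level x u ≤ 4 * (|x u| * √n) ^ 2 := by rw [h4]; gcongr
    _ = _ := by rw [mul_pow, sq_abs, Real.sq_sqrt hn.le]; ring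

/-- Rounding up to a power of 2 loses at most a factor 2, hence 4 after squaring: 4^s ≤ 4 n x_u² on
level s. -/
theorem sum_four_zpow_levels_le (hx : ∑ u, x u ^ 2 ≤ 1) :
    ∑ s ∈ levels x, 4 ^ s * ((levelSet x s).card : ℝ) ≤ 4 * n := by
  have h1 : ∑ s ∈ levels x, 4 ^ s * ((levelSet x s).card : ℝ) =
      ∑ u with x u ≠ 0, (4 : ℝ) ^ level x u := by
    rw [← Finset.sum_fiberwise_of_maps_to (t := levels x) (g := level x)
      (fun u hu => Finset.mem_image_of_mem _ hu)]
    refine Finset.sum_congr rfl fun s _ => ?_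
    rw [Finset.filter_filter]
    rw [Finset.sum_congr rfl (g := fun _ => (4 : ℝ) ^ s)
      (fun u hu => by rw [(Finset.mem_filter.1 hu).2.2])]
    rw [Finset.sum_const, nsmul_eq_mul, mul_comm, levelSet]
  rw [h1]
  calc ∑ u with x u ≠ 0, (4 : ℝ) ^ level x u ≤ ∑ u with x u ≠ 0, 4 * n * x u ^ 2 :=
        Finset.sum_le_sum fun u hu => four_zpow_level_le (Finset.mem_filter.1 hu).2
    _ ≤ ∑ u, 4 * n * x u ^ 2 :=
        Finset.sum_le_sum_of_subset_of_nonneg (Finset.filter_subset _ _) fun _ _ _ => by positivity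
    _ = 4 * n * ∑ u, x u ^ 2 := by rw [Finset.mul_sum]
    _ ≤ 4 * n * 1 := by gcongr
    _ = _ := by ring

end Levels

theorem blockSum_comm {n : ℕ} {A : Fin n → Fin n → ℝ} (hA : ∀ u v, A u v = A v u)
    (S T : Finset (Fin n)) : blockSum A S T = blockSum A T S := by
  rw [blockSum, blockSum, Finset.sum_comm]
  exact Finset.sum_congr rfl fun v _ => Finset.sum_congr rfl fun u _ => hA u v

theorem blockSum_nonneg {n : ℕ} {A : Fin n → Fin n → ℝ} (hA : ∀ u v, 0 ≤ A u v)
    (S T : Finset (Fin n)) : 0 ≤ blockSum A S T :=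
  Finset.sum_nonneg fun u _ => Finset.sum_nonneg fun v _ => hA u v

theorem blockSum_le_of_row {n : ℕ} {A : Fin n → Fin n → ℝ} (hA : ∀ u v, 0 ≤ A u v)
    {S T : Finset (Fin n)} {b : ℝ} (hb : ∀ u ∈ S, ∑ v, A u v ≤ b) :
    blockSum A S T ≤ b * S.card := by
  calc blockSum A S T ≤ ∑ u ∈ S, b := Finset.sum_le_sum fun u hu =>
        (Finset.sum_le_univ_sum_of_nonneg fun v => hA u v).trans (hb u hu)
    _ = _ := by rw [Finset.sum_const, nsmul_eq_mul, mul_comm]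

/-- The contribution of the pairs of levels that satisfy the entropy bound on the second side. -/
theorem sum_entropy_blocks_le {n : ℕ} (hn : 0 < n) {A : Fin n → Fin n → ℝ}
    (hA0 : ∀ u v, 0 ≤ A u v) {J : Finset (Fin n)} {d κ c g : ℝ} (hd : 0 < d)
    (hκ : 0 ≤ κ) (hc : 0 ≤ c) (hg : 0 < g) (hdeg : ∀ u ∈ J, ∑ v, A u v ≤ κ * d)
    {x y : Fin n → ℝ} (hx : ∑ u, x u ^ 2 ≤ 1) (hy : ∑ u, y u ^ 2 ≤ 1)
    (hxJ : ∀ u, x u ≠ 0 → u ∈ J) (R : Finset (ℤ × ℤ)) (hR : R ⊆ levels x ×ˢ levels y)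
    (hR1 : ∀ p ∈ R, Real.exp 2 * (g * d / n * (levelSet x p.1).card * (levelSet y p.2).card) <
      blockSum A (levelSet x p.1) (levelSet y p.2))
    (hR2 : ∀ p ∈ R, blockSum A (levelSet x p.1) (levelSet y p.2) *
      Real.log (blockSum A (levelSet x p.1) (levelSet y p.2) /
        (g * d / n * (levelSet x p.1).card * (levelSet y p.2).card)) ≤
        c * entropyWeight (levelSet y p.2)) :
    ∑ p ∈ R, 2 ^ p.1 * 2 ^ p.2 * blockSum A (levelSet x p.1) (levelSet y p.2) ≤
      (8 * κ + 50 * c + 48 * g) * (√d * n) := by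
  have hd2 : √d ^ 2 = d := Real.sq_sqrt hd.le
  refine sum_entropy_levels_le (levels x) (levels y) (fun s => ((levelSet x s).card : ℝ))
    (fun t => ((levelSet y t).card : ℝ)) (fun s t => blockSum A (levelSet x s) (levelSet y t))
    (N := n) (by exact_mod_cast hn) (Real.sqrt_pos.2 hd) hκ hc hg
    (fun s hs => by exact_mod_cast (levelSet_nonempty hs).card_pos)
    (fun s hs => by exact_mod_cast (levelSet_nonempty hs).card_pos)
    (fun t _ => by
      have := Finset.card_le_univ (levelSet y t)
      rw [Fintype.card_fin] at this
      exact_mod_cast this)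
    (sum_four_zpow_levels_le hx) (sum_four_zpow_levels_le hy)
    (fun s t => blockSum_nonneg hA0 _ _) (fun s _ t _ => ?_) R hR ?_ ?_
  · rw [hd2]
    exact blockSum_le_of_row hA0 fun u hu => hdeg u (hxJ u (ne_zero_of_mem_levelSet hu))
  · intro p hp
    rw [hd2]
    exact hR1 p hp
  · intro p hp
    rw [hd2]
    exact hR2 p hp

/-- Each heavy pair is charged to its pair of levels. Levels round |x_u|√n upwards, so |x_u y_v| ≤
2^s 2^t / n, and a heavy pair can only meet levels with 2^s 2^t > δ. -/
theorem heavy_sum_le_sum_levels {n : ℕ} (hn : 0 < n) {A : Fin n → Fin n → ℝ}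
    (hA0 : ∀ u v, 0 ≤ A u v) {δ : ℝ} (hδ : 0 < δ) (x y : Fin n → ℝ) :
    ∑ u, ∑ v, (if δ / n < |x u * y v| then |x u * y v| * A u v else 0) ≤
      (∑ p ∈ levels x ×ˢ levels y with δ < (2 : ℝ) ^ p.1 * 2 ^ p.2,
        2 ^ p.1 * 2 ^ p.2 * blockSum A (levelSet x p.1) (levelSet y p.2)) / n := by
  classical
  have hnR : (0 : ℝ) < n := by exact_mod_cast hn
  set Pr := (levels x ×ˢ levels y).filter fun p => δ < (2 : ℝ) ^ p.1 * 2 ^ p.2 with hPr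
  have hpt : ∀ u v, (if δ / n < |x u * y v| then |x u * y v| * A u v else 0) ≤
      ∑ p ∈ Pr, if u ∈ levelSet x p.1 then if v ∈ levelSet y p.2 then
        2 ^ p.1 * 2 ^ p.2 / n * A u v else 0 else 0 := by
    intro u v
    have hnn : ∀ p ∈ Pr, 0 ≤ if u ∈ levelSet x p.1 then if v ∈ levelSet y p.2 then
        2 ^ p.1 * 2 ^ p.2 / n * A u v else 0 else 0 := fun p _ => by
      have := hA0 u v
      positivity
    split_ifs with h
    · have hne : x u * y v ≠ 0 := by
        rw [← abs_pos]
        exact lt_trans (by positivity) h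
      have hxu : x u ≠ 0 := left_ne_zero_of_mul hne
      have hyv : y v ≠ 0 := right_ne_zero_of_mul hne
      have hle : |x u * y v| ≤ 2 ^ level x u * 2 ^ level y v / n := by
        rw [le_div_iff₀ hnR, abs_mul]
        calc |x u| * |y v| * n = (|x u| * √n) * (|y v| * √n) := by
              rw [mul_mul_mul_comm, Real.mul_self_sqrt hnR.le]
          _ ≤ _ := by
              gcongr
              · exact abs_mul_sqrt_le_two_zpow_level u
              · exact abs_mul_sqrt_le_two_zpow_level v
      have hmem : (level x u, level y v) ∈ Pr := by
        refine Finset.mem_filter.2 ⟨Finset.mem_product.2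
          ⟨level_mem_levels hxu, level_mem_levels hyv⟩, ?_⟩
        have := h.trans_le hle
        exact (div_lt_div_iff_of_pos_right hnR).1 this
      refine le_trans ?_ (Finset.single_le_sum hnn hmem)
      rw [if_pos (mem_levelSet_level hxu), if_pos (mem_levelSet_level hyv)]
      exact mul_le_mul_of_nonneg_right hle (hA0 u v)
    · exact Finset.sum_nonneg hnn
  refine (Finset.sum_le_sum fun u _ => Finset.sum_le_sum fun v _ => hpt u v).trans
    (le_of_eq ?_)
  rw [Finset.sum_div]
  have hcomm : ∀ (ι : Type) [Fintype ι] (F : ι → ℤ × ℤ → ℝ),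
      ∑ i, ∑ p ∈ Pr, F i p = ∑ p ∈ Pr, ∑ i, F i p := fun ι _ F => Finset.sum_comm
  simp_rw [hcomm]
  refine Finset.sum_congr rfl fun p _ => ?_
  have hrow : ∀ u, ∑ v, (if u ∈ levelSet x p.1 then if v ∈ levelSet y p.2 then
      2 ^ p.1 * 2 ^ p.2 / (n : ℝ) * A u v else 0 else 0) = if u ∈ levelSet x p.1 then
      2 ^ p.1 * 2 ^ p.2 / (n : ℝ) * ∑ v ∈ levelSet y p.2, A u v else 0 := by
    intro u
    split_ifs
    · rw [← Finset.sum_filter, Finset.filter_univ_mem, Finset.mul_sum]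
    · simp
  simp only [hrow]
  rw [← Finset.sum_filter, Finset.filter_univ_mem, ← Finset.mul_sum, blockSum]
  ring

/-- The contribution of the heavy pairs of levels whose block sum is comparable to its mean. -/
theorem sum_mean_blocks_le {n : ℕ} (hn : 0 < n) {A : Fin n → Fin n → ℝ} {d g : ℝ}
    (hd : 0 < d) (hg : 0 < g) {x y : Fin n → ℝ} (hx : ∑ u, x u ^ 2 ≤ 1) (hy : ∑ u, y u ^ 2 ≤ 1)
    (R : Finset (ℤ × ℤ)) (hR : R ⊆ levels x ×ˢ levels y)
    (hR1 : ∀ p ∈ R, √d < (2 : ℝ) ^ p.1 * 2 ^ p.2)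
    (hR2 : ∀ p ∈ R, blockSum A (levelSet x p.1) (levelSet y p.2) ≤
      Real.exp 2 * (g * d / n * (levelSet x p.1).card * (levelSet y p.2).card)) :
    ∑ p ∈ R, 2 ^ p.1 * 2 ^ p.2 * blockSum A (levelSet x p.1) (levelSet y p.2) ≤
      16 * Real.exp 2 * g * (√d * n) := by
  have hnR : (0 : ℝ) < n := by exact_mod_cast hn
  have hX := sum_four_zpow_levels_le hx
  have hY := sum_four_zpow_levels_le hy
  calc ∑ p ∈ R, 2 ^ p.1 * 2 ^ p.2 * blockSum A (levelSet x p.1) (levelSet y p.2)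
      ≤ ∑ p ∈ R, Real.exp 2 * g * √d / n * ((4 ^ p.1 * ((levelSet x p.1).card : ℝ)) *
        (4 ^ p.2 * ((levelSet y p.2).card : ℝ))) := by
        refine Finset.sum_le_sum fun p hp => ?_
        -- Heaviness trades one factor √d for a second 2^s 2^t; the resulting 4^s 4^t makes the sum
        -- factorise.
        have hlt := (hR1 p hp).le
        have h4 : ∀ s : ℤ, (4 : ℝ) ^ s = 2 ^ s * 2 ^ s := fun s => by
          rw [← mul_zpow]; norm_num
        have hgd : g * d / n = g * (√d * √d) / n := by rw [Real.mul_self_sqrt hd.le]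
        have h2 := hR2 p hp
        rw [hgd] at h2
        have hδ0 : 0 ≤ √d := Real.sqrt_nonneg d
        generalize √d = δ at *
        calc _ ≤ 2 ^ p.1 * 2 ^ p.2 * (Real.exp 2 * (g * (δ * δ) / n *
              (levelSet x p.1).card * (levelSet y p.2).card)) := by gcongr
          _ = Real.exp 2 * g * δ / n * ((levelSet x p.1).card * (levelSet y p.2).card) *
              (2 ^ p.1 * 2 ^ p.2) * δ := by ring
          _ ≤ Real.exp 2 * g * δ / n * ((levelSet x p.1).card * (levelSet y p.2).card) *
              (2 ^ p.1 * 2 ^ p.2) * (2 ^ p.1 * 2 ^ p.2) := by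
              gcongr
          _ = _ := by rw [h4, h4]; ring
    _ ≤ ∑ p ∈ levels x ×ˢ levels y, Real.exp 2 * g * √d / n *
        ((4 ^ p.1 * ((levelSet x p.1).card : ℝ)) * (4 ^ p.2 * ((levelSet y p.2).card : ℝ))) :=
        Finset.sum_le_sum_of_subset_of_nonneg hR fun _ _ _ => by positivity
    _ = Real.exp 2 * g * √d / n * ((∑ s ∈ levels x, 4 ^ s * ((levelSet x s).card : ℝ)) *
        ∑ t ∈ levels y, 4 ^ t * ((levelSet y t).card : ℝ)) := by
        rw [← Finset.mul_sum, Finset.sum_product, Finset.sum_mul_sum]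
    _ ≤ Real.exp 2 * g * √d / n * ((4 * n) * (4 * n)) := by gcongr
    _ = _ := by field_simp; ring

/-- The heavy pairs contribute at most a constant times `√d` to the bilinear form of a nonnegative
matrix with bounded discrepancy and bounded row sums. -/
theorem heavy_sum_le {n : ℕ} (hn : 0 < n) {A : Fin n → Fin n → ℝ}
    (hA0 : ∀ u v, 0 ≤ A u v) (hAs : ∀ u v, A u v = A v u) {J : Finset (Fin n)} {d κ c g : ℝ}
    (hd : 0 < d) (hκ : 0 ≤ κ) (hc : 0 ≤ c) (hg : 0 < g)
    (hdeg : ∀ u ∈ J, ∑ v, A u v ≤ κ * d) (hdisc : BoundedDiscrepancy A (g * d / n) c)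
    {x y : Fin n → ℝ} (hx : ∑ u, x u ^ 2 ≤ 1) (hy : ∑ u, y u ^ 2 ≤ 1)
    (hxJ : ∀ u, x u ≠ 0 → u ∈ J) (hyJ : ∀ u, y u ≠ 0 → u ∈ J) :
    ∑ u, ∑ v, (if √d / n < |x u * y v| then |x u * y v| * A u v else 0) ≤
      (16 * Real.exp 2 * g + 2 * (8 * κ + 50 * c + 48 * g)) * √d := by
  classical
  have hnR : (0 : ℝ) < n := by exact_mod_cast hn
  have hδ : 0 < √d := Real.sqrt_pos.2 hd
  have step1 := heavy_sum_le_sum_levels hn hA0 hδ x y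
  set Pr := (levels x ×ˢ levels y).filter fun p => √d < (2 : ℝ) ^ p.1 * 2 ^ p.2 with hPr
  have hPrS : Pr ⊆ levels x ×ˢ levels y := Finset.filter_subset _ _
  obtain ⟨f, hf⟩ : ∃ f : ℤ × ℤ → ℝ, ∀ p, f p =
      2 ^ p.1 * 2 ^ p.2 * blockSum A (levelSet x p.1) (levelSet y p.2) := ⟨_, fun _ => rfl⟩
  have hf0 : ∀ p, 0 ≤ f p := fun p => by
    rw [hf]
    exact mul_nonneg (by positivity) (blockSum_nonneg hA0 _ _)
  -- The alternatives of the discrepancy property: `R₀` is comparable to the mean, `R₁` is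
  -- controlled by the entropy of the second side. The rest `R₂` is controlled by the first side and
  -- reduces to the case of `R₁` by exchanging x and y, as A is symmetric.
  set R₀ := Pr.filter fun p => blockSum A (levelSet x p.1) (levelSet y p.2) ≤
    Real.exp 2 * (g * d / n * (levelSet x p.1).card * (levelSet y p.2).card) with hR₀
  set R₁ := (Pr \ R₀).filter fun p => blockSum A (levelSet x p.1) (levelSet y p.2) *
      Real.log (blockSum A (levelSet x p.1) (levelSet y p.2) /
        (g * d / n * (levelSet x p.1).card * (levelSet y p.2).card)) ≤
        c * entropyWeight (levelSet y p.2) with hR₁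
  set R₂ := (Pr \ R₀) \ R₁ with hR₂
  have hlt : ∀ p ∈ Pr \ R₀, Real.exp 2 *
      (g * d / n * (levelSet x p.1).card * (levelSet y p.2).card) <
      blockSum A (levelSet x p.1) (levelSet y p.2) := by
    intro p hp
    obtain ⟨h1, h2⟩ := Finset.mem_sdiff.1 hp
    by_contra hcon
    exact h2 (Finset.mem_filter.2 ⟨h1, not_lt.1 hcon⟩)
  have hR₁m : ∀ p ∈ R₁, p ∈ Pr \ R₀ := fun p hp => (Finset.mem_filter.1 hp).1
  have hR₂m : ∀ p ∈ R₂, p ∈ Pr \ R₀ := fun p hp => (Finset.mem_sdiff.1 hp).1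
  have hmem : ∀ p ∈ Pr \ R₀, p ∈ levels x ×ˢ levels y := fun p hp =>
    hPrS (Finset.mem_sdiff.1 hp).1
  have hR₂e : ∀ p ∈ R₂, blockSum A (levelSet x p.1) (levelSet y p.2) *
      Real.log (blockSum A (levelSet x p.1) (levelSet y p.2) /
        (g * d / n * (levelSet x p.1).card * (levelSet y p.2).card)) ≤
        c * entropyWeight (levelSet x p.1) := by
    intro p hp
    obtain ⟨h1, h2⟩ := Finset.mem_sdiff.1 hp
    have hpm := Finset.mem_product.1 (hmem p h1)
    rcases hdisc _ _ (levelSet_nonempty hpm.1) (levelSet_nonempty hpm.2) with h | h | h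
    · exact absurd (hlt p h1) (not_lt.2 h)
    · exact h
    · exact absurd (Finset.mem_filter.2 ⟨h1, h⟩) h2
  have b0 : ∑ p ∈ R₀, f p ≤ 16 * Real.exp 2 * g * (√d * n) := by
    simp only [hf]
    exact sum_mean_blocks_le hn hd hg hx hy R₀ ((Finset.filter_subset _ _).trans hPrS)
      (fun p hp => (Finset.mem_filter.1 (Finset.mem_filter.1 hp).1).2)
      (fun p hp => (Finset.mem_filter.1 hp).2)
  have b1 : ∑ p ∈ R₁, f p ≤ (8 * κ + 50 * c + 48 * g) * (√d * n) := by
    simp only [hf]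
    exact sum_entropy_blocks_le hn hA0 hd hκ hc hg hdeg hx hy hxJ R₁
      (fun p hp => hmem p (hR₁m p hp)) (fun p hp => hlt p (hR₁m p hp))
      (fun p hp => (Finset.mem_filter.1 hp).2)
  have b2 : ∑ p ∈ R₂, f p ≤ (8 * κ + 50 * c + 48 * g) * (√d * n) := by
    have h := sum_entropy_blocks_le hn hA0 hd hκ hc hg hdeg hy hx hyJ (R₂.image Prod.swap)
      (by
        intro p hp
        obtain ⟨p', hp', rfl⟩ := Finset.mem_image.1 hp
        have := Finset.mem_product.1 (hmem p' (hR₂m p' hp'))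
        exact Finset.mem_product.2 ⟨this.2, this.1⟩)
      (by
        intro p hp
        obtain ⟨⟨s, t⟩, hp', rfl⟩ := Finset.mem_image.1 hp
        have := hlt _ (hR₂m _ hp')
        rw [blockSum_comm hAs, mul_right_comm] at this
        exact this)
      (by
        intro p hp
        obtain ⟨⟨s, t⟩, hp', rfl⟩ := Finset.mem_image.1 hp
        have := hR₂e _ hp'
        rw [blockSum_comm hAs, mul_right_comm (g * d / n)] at this
        exact this)
    rw [Finset.sum_image (fun a _ b _ h => Prod.swap_injective h)] at h
    refine le_trans (le_of_eq (Finset.sum_congr rfl ?_)) h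
    rintro ⟨s, t⟩ -
    rw [hf, blockSum_comm hAs, mul_comm ((2 : ℝ) ^ _)]
    rfl
  have total : ∑ p ∈ Pr, f p ≤
      (16 * Real.exp 2 * g + 2 * (8 * κ + 50 * c + 48 * g)) * (√d * n) := by
    have e1 := Finset.sum_sdiff (f := f) (Finset.filter_subset _ _ : R₀ ⊆ Pr)
    have e2 := Finset.sum_sdiff (f := f) (Finset.filter_subset _ _ : R₁ ⊆ Pr \ R₀)
    linarith
  simp only [hf] at total
  refine step1.trans ?_
  rw [div_le_iff₀ hnR]
  linarith

/-! ### Light pairs -/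

/-- The bilinear form with coefficients `f`, as a sum over hyperedges. -/
theorem sum_mul_adjMatrix {n : ℕ} (f : Fin n → Fin n → ℝ) (h : Hypergraph n) :
    ∑ u, ∑ v, f u v * adjMatrix h u v = edgeSum (fun e => ∑ q ∈ e.offDiag, f q.1 q.2) h := by
  simp only [adjMatrix_eq_edgeSum, edgeSum, Finset.mul_sum]
  rw [← Finset.sum_product', Finset.sum_comm]
  refine Finset.sum_congr rfl fun e _ => ?_
  simp only [mul_ite, mul_one, mul_zero]
  rw [← Finset.sum_filter]
  refine Finset.sum_congr ?_ fun _ _ => rfl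
  ext q
  simp [Finset.mem_offDiag]
  tauto

theorem IsErdosRenyi.sum_mul_meanAdjMatrix {n : ℕ} {Ω : Type*} [MeasurableSpace Ω]
    {P : Measure Ω} [IsProbabilityMeasure P] {𝓜 : Finset ℕ}
    {Q : (m : ℕ) → (Fin m → Fin n) → ℝ} {H : Ω → Hypergraph n} (hH : IsErdosRenyi P 𝓜 Q H)
    (f : Fin n → Fin n → ℝ) :
    ∑ u, ∑ v, f u v * meanAdjMatrix P H u v =
      ∑ e, (∑ q ∈ e.offDiag, f q.1 q.2) * edgeProb P H e := by
  simp only [hH.meanAdjMatrix_apply, Finset.mul_sum]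
  rw [← Finset.sum_product', Finset.sum_comm]
  refine Finset.sum_congr rfl fun e _ => ?_
  simp only [ite_mul, one_mul, zero_mul, mul_ite, mul_zero]
  rw [← Finset.sum_filter, Finset.sum_mul]
  refine Finset.sum_congr ?_ fun _ _ => rfl
  ext q
  simp [Finset.mem_offDiag]
  tauto

theorem card_offDiag_le {n : ℕ} {e : Finset (Fin n)} {M : ℕ} (he : e.card ≤ M) :
    (e.offDiag.card : ℝ) ≤ M * (M - 1) := by
  rw [Finset.offDiag_card, Nat.cast_sub (Nat.le_mul_self _), Nat.cast_mul]
  have h1 : (e.card : ℝ) ≤ M := by exact_mod_cast he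
  rcases Nat.eq_zero_or_pos e.card with h0 | h0
  · rw [h0]
    rcases Nat.eq_zero_or_pos M with hM | hM
    · simp [hM]
    · have : (1 : ℝ) ≤ M := by exact_mod_cast hM
      norm_num
      nlinarith
  · have h2 : (1 : ℝ) ≤ e.card := by exact_mod_cast h0
    nlinarith

section Light

variable {n : ℕ} {Ω : Type*} [MeasurableSpace Ω] {P : Measure Ω} [IsProbabilityMeasure P]
  {𝓜 : Finset ℕ} {Q : (m : ℕ) → (Fin m → Fin n) → ℝ} {H : Ω → Hypergraph n} {M : ℕ}

/-- A bilinear form in the centred adjacency matrix with coefficients of size at most `√d / n` has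
exponentially small upper tails. -/
theorem IsErdosRenyi.prob_light_ge_le (hH : IsErdosRenyi P 𝓜 Q H) (hM : ∀ m ∈ 𝓜, m ≤ M)
    (h2 : ∀ m ∈ 𝓜, 2 ≤ m) (hM2 : 2 ≤ M) (hn : 0 < n) (hd : 0 < dMax 𝓜 Q)
    (f : Fin n → Fin n → ℝ) (hf : ∀ u v, |f u v| ≤ √(dMax 𝓜 Q) / n)
    (hf2 : ∑ u, ∑ v, f u v ^ 2 ≤ 1) :
    P.real {ω | 7 * (M * (M - 1)) * √(dMax 𝓜 Q) ≤
      ∑ u, ∑ v, f u v * (adjMatrix (H ω) u v - meanAdjMatrix P H u v)} ≤ Real.exp (-(6 * n)) := by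
  set d := dMax 𝓜 Q with hdd
  set δ := √d with hδd
  have hδ : 0 < δ := Real.sqrt_pos.2 hd
  have hδ2 : δ ^ 2 = d := Real.sq_sqrt hd.le
  have hnR : (0 : ℝ) < n := by exact_mod_cast hn
  have hMR : (2 : ℝ) ≤ M := by exact_mod_cast hM2
  set W : ℝ := M * (M - 1) with hW
  have hW0 : 0 < W := by rw [hW]; nlinarith
  set a : Finset (Fin n) → ℝ := fun e => ∑ q ∈ e.offDiag, f q.1 q.2 with ha
  -- A hyperedge carries at most W = M(M-1) ordered pairs with coefficients at most δ/n, so this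
  -- tilt keeps |θ a(e)| ≤ 1, where e^z ≤ 1 + z + z² applies.
  set θ : ℝ := n / (W * δ) with hθ
  have hθ0 : 0 < θ := by positivity
  set m := ∑ e, a e * edgeProb P H e with hm
  have hsub : {ω | 7 * W * δ ≤
      ∑ u, ∑ v, f u v * (adjMatrix (H ω) u v - meanAdjMatrix P H u v)} ⊆
      {ω | θ * (7 * W * δ + m) ≤ edgeSum (fun e => θ * a e) (H ω)} := by
    intro ω hω
    simp only [Set.mem_ofPred_eq, mul_sub, Finset.sum_sub_distrib] at hω ⊢
    rw [sum_mul_adjMatrix, hH.sum_mul_meanAdjMatrix] at hω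
    rw [edgeSum, ← Finset.mul_sum]
    change _ ≤ edgeSum a (H ω) - m at hω
    refine mul_le_mul_of_nonneg_left ?_ hθ0.le
    rw [edgeSum] at hω
    linarith
  refine (measureReal_mono hsub).trans ((prob_le_edgeSum_le hH.measurableSet hH.indep _ _).trans ?_)
  rw [Real.exp_le_exp]
  have habs : ∀ e, edgeProb P H e ≠ 0 → |θ * a e| ≤ 1 := by
    intro e he
    have hcard := card_offDiag_le (hM _ (hH.card_mem_of_edgeProb_ne_zero he))
    have h1 : |a e| ≤ W * (δ / n) := by
      calc |a e| ≤ ∑ q ∈ e.offDiag, |f q.1 q.2| := Finset.abs_sum_le_sum_abs _ _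
        _ ≤ e.offDiag.card * (δ / n) := by
            simpa using Finset.sum_le_card_nsmul e.offDiag _ _ fun q _ => hf q.1 q.2
        _ ≤ W * (δ / n) := by gcongr
    rw [abs_mul, abs_of_pos hθ0]
    calc θ * |a e| ≤ θ * (W * (δ / n)) := by gcongr
      _ = 1 := by rw [hθ]; field_simp
  have hterm : ∀ e, edgeProb P H e * (Real.exp (θ * a e) - 1) ≤
      θ * (a e * edgeProb P H e) +
        θ ^ 2 * W * (edgeProb P H e * ∑ q ∈ e.offDiag, f q.1 q.2 ^ 2) := by
    intro e
    by_cases he : edgeProb P H e = 0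
    · simp [he]
    have h1 := (abs_le.1 (Real.abs_exp_sub_one_sub_id_le (habs e he))).2
    have hcard := card_offDiag_le (hM _ (hH.card_mem_of_edgeProb_ne_zero he))
    have h3 : a e ^ 2 ≤ W * ∑ q ∈ e.offDiag, f q.1 q.2 ^ 2 :=
      sq_sum_le_card_mul_sum_sq.trans (mul_le_mul_of_nonneg_right hcard
        (Finset.sum_nonneg fun _ _ => sq_nonneg _))
    have hp := edgeProb_nonneg (P := P) (H := H) e
    calc edgeProb P H e * (Real.exp (θ * a e) - 1)
        ≤ edgeProb P H e * (θ * a e + θ ^ 2 * a e ^ 2) := by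
          refine mul_le_mul_of_nonneg_left ?_ hp
          linarith [mul_pow θ (a e) 2]
      _ ≤ edgeProb P H e * (θ * a e + θ ^ 2 * (W * ∑ q ∈ e.offDiag, f q.1 q.2 ^ 2)) := by gcongr
      _ = _ := by ring
  have hvar : ∑ e, edgeProb P H e * ∑ q ∈ e.offDiag, f q.1 q.2 ^ 2 ≤ 2 * (M - 1) * d / n := by
    have h1 := hH.sum_mul_meanAdjMatrix fun u v => f u v ^ 2
    simp only [mul_comm (edgeProb P H _)]
    rw [← h1]
    calc ∑ u, ∑ v, f u v ^ 2 * meanAdjMatrix P H u v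
        ≤ ∑ u, ∑ v, f u v ^ 2 * (2 * (M - 1) * d / n) := by
          gcongr with u _ v _
          exact hH.meanAdjMatrix_le hM (by omega) h2 u v
      _ = (∑ u, ∑ v, f u v ^ 2) * (2 * (M - 1) * d / n) := by simp only [Finset.sum_mul]
      _ ≤ 1 * (2 * (M - 1) * d / n) := by
          have : (0 : ℝ) ≤ M - 1 := by linarith
          gcongr
      _ = _ := one_mul _
  have hsum := Finset.sum_le_sum fun e (_ : e ∈ (Finset.univ : Finset (Finset (Fin n)))) => hterm e
  rw [Finset.sum_add_distrib, ← Finset.mul_sum, ← Finset.mul_sum] at hsum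
  -- The second-order term is 2n/M ≤ n, which leaves 7n - n = 6n in the exponent.
  have h5 : θ ^ 2 * W * (∑ e, edgeProb P H e * ∑ q ∈ e.offDiag, f q.1 q.2 ^ 2) ≤ n := by
    calc _ ≤ θ ^ 2 * W * (2 * (M - 1) * d / n) := by gcongr
      _ = n * (2 / M) := by
          rw [hθ, ← hδ2, hW]
          have : (M : ℝ) - 1 ≠ 0 := by linarith
          field_simp
      _ ≤ n * 1 := by
          gcongr
          rw [div_le_one (by linarith)]
          exact hMR
      _ = n := mul_one _
  have h6 : θ * (7 * W * δ + m) = 7 * n + θ * m := by rw [hθ]; field_simp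
  rw [h6]
  linarith

/-- The light coefficients of a bilinear form restricted to `J`. -/
noncomputable def lightCoeff (J : Finset (Fin n)) (τ : ℝ) (x y : Fin n → ℝ) (u v : Fin n) : ℝ :=
  if (u ∈ J ∧ v ∈ J) ∧ |x u * y v| ≤ τ then x u * y v else 0

/-- The light pairs are under control for all vectors of a net and all sets of vertices. -/
def LightBound {n : ℕ} (N : Finset (EuclideanSpace ℝ (Fin n))) (B : Fin n → Fin n → ℝ)
    (τ K : ℝ) : Prop :=
  ∀ J, ∀ x ∈ N, ∀ y ∈ N, ∑ u, ∑ v, lightCoeff J τ x y u v * B u v ≤ K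

/-- A union over 2^n sets J and 81^n pairs of net points, against a tail e^(-6n) for each. Including
all J makes the bound usable for sets chosen from the hypergraph. The rate results from 81 ≤ e^5. -/
theorem IsErdosRenyi.prob_not_lightBound_le (hH : IsErdosRenyi P 𝓜 Q H)
    (hM : ∀ m ∈ 𝓜, m ≤ M) (h2 : ∀ m ∈ 𝓜, 2 ≤ m) (hM2 : 2 ≤ M) (hn : 0 < n)
    (hd : 0 < dMax 𝓜 Q) {N : Finset (EuclideanSpace ℝ (Fin n))} (hN : N.card ≤ 9 ^ n)
    (hN1 : ∀ x ∈ N, ∑ u, x u ^ 2 ≤ 1) :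
    P.real {ω | ¬ LightBound N (fun u v => adjMatrix (H ω) u v - meanAdjMatrix P H u v)
      (√(dMax 𝓜 Q) / n) (7 * (M * (M - 1)) * √(dMax 𝓜 Q))} ≤
      (Real.exp 1 / 2) ^ (-(n : ℝ)) := by
  classical
  set d := dMax 𝓜 Q
  set I : Finset (Finset (Fin n) × EuclideanSpace ℝ (Fin n) × EuclideanSpace ℝ (Fin n)) :=
    Finset.univ ×ˢ N ×ˢ N with hI
  have hsub : {ω | ¬ LightBound N (fun u v => adjMatrix (H ω) u v - meanAdjMatrix P H u v)
      (√d / n) (7 * (M * (M - 1)) * √d)} ⊆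
      ⋃ i ∈ I, {ω | 7 * (M * (M - 1)) * √d ≤ ∑ u, ∑ v, lightCoeff i.1 (√d / n) i.2.1 i.2.2 u v *
        (adjMatrix (H ω) u v - meanAdjMatrix P H u v)} := by
    intro ω hω
    simp only [LightBound, Set.mem_ofPred_eq, not_forall, not_le] at hω
    obtain ⟨J, x, hx, y, hy, h⟩ := hω
    simp only [Set.mem_iUnion]
    exact ⟨(J, x, y), by simp [hI, hx, hy], h.le⟩
  refine (measureReal_mono hsub (measure_ne_top _ _)).trans ((measureReal_biUnion_finset_le _ _).trans ?_)
  have hone : ∀ i ∈ I, P.real {ω | 7 * (M * (M - 1)) * √d ≤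
      ∑ u, ∑ v, lightCoeff i.1 (√d / n) i.2.1 i.2.2 u v *
        (adjMatrix (H ω) u v - meanAdjMatrix P H u v)} ≤ Real.exp (-(6 * n)) := by
    rintro ⟨J, x, y⟩ hi
    simp only [hI, Finset.mem_product, Finset.mem_univ, true_and] at hi
    refine hH.prob_light_ge_le hM h2 hM2 hn hd _ (fun u v => ?_) ?_
    · simp only [lightCoeff]
      split_ifs with h
      · exact h.2
      · rw [abs_zero]; positivity
    · calc ∑ u, ∑ v, lightCoeff J (√d / n) x y u v ^ 2 ≤ ∑ u, ∑ v, x u ^ 2 * y v ^ 2 := by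
            gcongr with u _ v _
            simp only [lightCoeff]
            split_ifs with h
            · rw [mul_pow]
            · rw [zero_pow two_ne_zero]; positivity
        _ = (∑ u, x u ^ 2) * ∑ v, y v ^ 2 := by rw [Finset.sum_mul_sum]
        _ ≤ 1 * 1 := by
            gcongr
            · exact hN1 x hi.1
            · exact hN1 y hi.2
        _ = 1 := one_mul 1
  have hcard : (I.card : ℝ) ≤ 2 ^ n * (9 ^ n * 9 ^ n) := by
    have : I.card ≤ 2 ^ n * (9 ^ n * 9 ^ n) := by
      rw [hI, Finset.card_product, Finset.card_product, Finset.card_univ, Fintype.card_finset,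
        Fintype.card_fin]
      gcongr
    exact_mod_cast this
  have h81 : (81 : ℝ) ≤ Real.exp 1 ^ 5 := by
    have h1 : (2.7 : ℝ) ≤ Real.exp 1 := by linarith [Real.exp_one_gt_d9]
    calc (81 : ℝ) ≤ 2.7 ^ 5 := by norm_num
      _ ≤ _ := by gcongr
  calc _ ≤ (I.card : ℝ) * Real.exp (-(6 * n)) := by
        simpa using Finset.sum_le_card_nsmul I _ _ hone
    _ ≤ 2 ^ n * (9 ^ n * 9 ^ n) * Real.exp (-(6 * n)) := by gcongr
    _ = (2 * 81 * (Real.exp 1 ^ 6)⁻¹) ^ n := by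
        have : Real.exp (-(6 * n)) = ((Real.exp 1 ^ 6)⁻¹) ^ n := by
          rw [← Real.exp_nat_mul, ← Real.exp_neg, ← Real.exp_nat_mul]
          congr 1
          push_cast
          ring
        rw [this, ← mul_pow, ← mul_pow, ← mul_pow]
        norm_num
    _ ≤ (2 * Real.exp 1 ^ 5 * (Real.exp 1 ^ 6)⁻¹) ^ n := by gcongr
    _ = (Real.exp 1 / 2) ^ (-(n : ℝ)) := by
        have hpos := Real.exp_pos 1
        have h : 2 * Real.exp 1 ^ 5 * (Real.exp 1 ^ 6)⁻¹ = (Real.exp 1 / 2)⁻¹ := by field_simp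
        rw [h, inv_pow, Real.rpow_neg (by positivity), Real.rpow_natCast]

end Light

/-! ### Probability of the discrepancy property -/

/-- The number of vertex sets of a given size, in terms of their entropy. -/
theorem choose_le_exp_entropy {n a : ℕ} (ha : 0 < a) :
    (n.choose a : ℝ) ≤ Real.exp (a * Real.log (Real.exp 1 * n / a)) := by
  have haR : (0 : ℝ) < a := by exact_mod_cast ha
  rcases Nat.eq_zero_or_pos n with rfl | hn
  · rw [Nat.choose_eq_zero_of_lt ha]
    simp
  have hnR : (0 : ℝ) < n := by exact_mod_cast hn
  have h1 : (n.choose a : ℝ) ≤ n ^ a / a.factorial := by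
    simpa using Nat.choose_le_pow_div (α := ℝ) a n
  have h2 : (a : ℝ) ^ a / a.factorial ≤ Real.exp a := Real.pow_div_factorial_le_exp _ haR.le a
  have h3 : Real.exp (a * Real.log (Real.exp 1 * n / a)) = Real.exp a * (n / a) ^ a := by
    rw [mul_comm (a : ℝ), mul_comm _ (a : ℝ), Real.exp_nat_mul, Real.exp_log (by positivity),
      mul_div_assoc, mul_pow, ← Real.exp_nat_mul, mul_one]
  rw [h3]
  refine h1.trans ?_
  calc (n : ℝ) ^ a / a.factorial = a ^ a / a.factorial * (n / a) ^ a := by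
        rw [div_pow]; field_simp
    _ ≤ _ := by gcongr

/-- The entropy of a nonempty vertex set is at least that of a single vertex. -/
theorem log_le_entropyWeight {n : ℕ} {S : Finset (Fin n)} (hS : S.Nonempty) :
    1 + Real.log n ≤ entropyWeight S := by
  have ha : 1 ≤ S.card := hS.card_pos
  have hle : S.card ≤ n := by simpa using Finset.card_le_univ S
  have haR : (1 : ℝ) ≤ S.card := by exact_mod_cast ha
  have hleR : (S.card : ℝ) ≤ n := by exact_mod_cast hle
  have hnR : (0 : ℝ) < n := by linarith
  rw [entropyWeight, Real.log_div (by positivity) (by positivity),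
    Real.log_mul (by positivity) (by positivity), Real.log_exp]
  generalize (S.card : ℝ) = a at *
  have h1 : Real.log a ≤ Real.log n := Real.log_le_log (by linarith) hleR
  have h2 : Real.log a ≤ a - 1 := Real.log_le_sub_one_of_pos (by linarith)
  have h3 : a * Real.log a - Real.log a ≤ (a - 1) * Real.log n := by
    rw [← sub_one_mul]
    exact mul_le_mul_of_nonneg_left h1 (by linarith)
  have h4 : -Real.log n ≤ -Real.log a := by linarith
  nlinarith

/-- One of the seven units of entropy cancels the number of sets of a given size, leaving at most n
for the n sizes; the other six give n^(-6), since the entropy is at least 1 + log n. -/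
theorem sum_exp_neg_entropy_le {n : ℕ} (hn : 0 < n) :
    ∑ S : Finset (Fin n) with S.Nonempty, Real.exp (-(7 * entropyWeight S)) ≤
      (n : ℝ) ^ (-(5 : ℝ)) := by
  have hnR : (0 : ℝ) < n := by exact_mod_cast hn
  have h1 : ∑ S : Finset (Fin n) with S.Nonempty, Real.exp (-(7 * entropyWeight S)) ≤
      ∑ S : Finset (Fin n) with S.Nonempty,
        Real.exp (-(6 * (1 + Real.log n))) * Real.exp (-entropyWeight S) := by
    refine Finset.sum_le_sum fun S hS => ?_
    rw [← Real.exp_add, Real.exp_le_exp]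
    linarith [log_le_entropyWeight (Finset.mem_filter.1 hS).2]
  have h2 : ∑ S : Finset (Fin n) with S.Nonempty, Real.exp (-entropyWeight S) ≤ n := by
    have hmaps : ∀ S ∈ (Finset.univ : Finset (Finset (Fin n))).filter Finset.Nonempty,
        S.card ∈ Finset.Icc 1 n := by
      intro S hS
      have h := (Finset.mem_filter.1 hS).2.card_pos
      have h' : S.card ≤ n := by simpa using Finset.card_le_univ S
      exact Finset.mem_Icc.2 ⟨h, h'⟩
    rw [← Finset.sum_fiberwise_of_maps_to hmaps]
    calc _ ≤ ∑ a ∈ Finset.Icc 1 n, (1 : ℝ) := by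
          refine Finset.sum_le_sum fun a ha => ?_
          have ha1 : 0 < a := (Finset.mem_Icc.1 ha).1
          have hcard : ((((Finset.univ : Finset (Finset (Fin n))).filter
              Finset.Nonempty).filter fun S => S.card = a).card : ℝ) ≤ n.choose a := by
            have : (((Finset.univ : Finset (Finset (Fin n))).filter
                Finset.Nonempty).filter fun S => S.card = a).card ≤
                (Finset.powersetCard a (Finset.univ : Finset (Fin n))).card := by
              refine Finset.card_le_card fun S hS => ?_
              exact Finset.mem_powersetCard.2 ⟨Finset.subset_univ _, (Finset.mem_filter.1 hS).2⟩
            rw [Finset.card_powersetCard, Finset.card_univ, Fintype.card_fin] at this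
            exact_mod_cast this
          calc _ = ((((Finset.univ : Finset (Finset (Fin n))).filter
              Finset.Nonempty).filter fun S => S.card = a).card : ℝ) *
                Real.exp (-(a * Real.log (Real.exp 1 * n / a))) := by
                rw [← nsmul_eq_mul, ← Finset.sum_const]
                refine Finset.sum_congr rfl fun S hS => ?_
                rw [entropyWeight, (Finset.mem_filter.1 hS).2]
            _ ≤ Real.exp (a * Real.log (Real.exp 1 * n / a)) *
                Real.exp (-(a * Real.log (Real.exp 1 * n / a))) := by
                gcongr
                exact hcard.trans (choose_le_exp_entropy ha1)
            _ = 1 := by rw [← Real.exp_add, add_neg_cancel, Real.exp_zero]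
      _ = n := by simp
  have h3 : Real.exp (-(6 * (1 + Real.log n))) ≤ (n : ℝ) ^ (-(6 : ℝ)) := by
    rw [Real.rpow_def_of_pos hnR, Real.exp_le_exp]
    linarith
  rw [← Finset.mul_sum] at h1
  calc _ ≤ _ := h1
    _ ≤ (n : ℝ) ^ (-(6 : ℝ)) * n := by gcongr
    _ = (n : ℝ) ^ (-(5 : ℝ)) := by
        rw [← Real.rpow_add_one hnR.ne']
        norm_num

section Discrepancy

variable {n : ℕ} {Ω : Type*} [MeasurableSpace Ω] {P : Measure Ω} [IsProbabilityMeasure P]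
  {𝓜 : Finset ℕ} {Q : (m : ℕ) → (Fin m → Fin n) → ℝ} {H : Ω → Hypergraph n} {M : ℕ}

theorem blockSum_eq_sum_indicator (A : Fin n → Fin n → ℝ) (S T : Finset (Fin n)) :
    blockSum A S T = ∑ u, ∑ v, (if u ∈ S ∧ v ∈ T then (1 : ℝ) else 0) * A u v := by
  have hrow : ∀ u, ∑ v, (if u ∈ S ∧ v ∈ T then (1 : ℝ) else 0) * A u v =
      if u ∈ S then ∑ v ∈ T, A u v else 0 := by
    intro u
    by_cases hu : u ∈ S
    · simp only [hu, true_and, if_true, ite_mul, one_mul, zero_mul]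
      rw [← Finset.sum_filter, Finset.filter_univ_mem]
    · simp [hu]
  simp only [hrow, blockSum]
  rw [← Finset.sum_filter, Finset.filter_univ_mem]

/-- Chernoff for the block sum, where a hyperedge has weight at most W = M(M-1). If all alternatives
fail, X log(X/μ) exceeds 28W times either entropy, hence 14W times their sum, that is 2Wτ with τ
seven times the sum. The bound is a product so that the union over pairs of sets factorises. -/
theorem IsErdosRenyi.prob_large_blockSum_le (hH : IsErdosRenyi P 𝓜 Q H) (hM : ∀ m ∈ 𝓜, m ≤ M)
    (h2 : ∀ m ∈ 𝓜, 2 ≤ m) (hM2 : 2 ≤ M) (hn : 0 < n) (hd : 0 < dMax 𝓜 Q)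
    {S T : Finset (Fin n)} (hS : S.Nonempty) (hT : T.Nonempty) :
    P.real {ω | ¬ (blockSum (adjMatrix (H ω)) S T ≤
        Real.exp 2 * (2 * (M - 1) * dMax 𝓜 Q / n * S.card * T.card) ∨
      blockSum (adjMatrix (H ω)) S T * Real.log (blockSum (adjMatrix (H ω)) S T /
        (2 * (M - 1) * dMax 𝓜 Q / n * S.card * T.card)) ≤
          28 * (M * (M - 1)) * entropyWeight S ∨
      blockSum (adjMatrix (H ω)) S T * Real.log (blockSum (adjMatrix (H ω)) S T /
        (2 * (M - 1) * dMax 𝓜 Q / n * S.card * T.card)) ≤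
          28 * (M * (M - 1)) * entropyWeight T)} ≤
      Real.exp (-(7 * entropyWeight S)) * Real.exp (-(7 * entropyWeight T)) := by
  set d := dMax 𝓜 Q
  have hnR : (0 : ℝ) < n := by exact_mod_cast hn
  have hMR : (2 : ℝ) ≤ M := by exact_mod_cast hM2
  have hM1 : (0 : ℝ) < M - 1 := by linarith
  have hSR : (0 : ℝ) < S.card := by exact_mod_cast hS.card_pos
  have hTR : (0 : ℝ) < T.card := by exact_mod_cast hT.card_pos
  set μ : ℝ := 2 * (M - 1) * d / n * S.card * T.card with hμ
  have hμ0 : 0 < μ := by positivity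
  set w : Finset (Fin n) → ℝ := fun e =>
    ∑ q ∈ e.offDiag, if q.1 ∈ S ∧ q.2 ∈ T then (1 : ℝ) else 0 with hw
  have hX : ∀ h : Hypergraph n, blockSum (adjMatrix h) S T = edgeSum w h := fun h =>
    (blockSum_eq_sum_indicator _ S T).trans
      (sum_mul_adjMatrix (fun u v => if u ∈ S ∧ v ∈ T then (1 : ℝ) else 0) h)
  rw [← Real.exp_add, ← neg_add]
  simp only [hX, not_or, not_le]
  refine prob_large_edgeSum_le hH.measurableSet hH.indep (w := w) (W := M * (M - 1)) (μ := μ)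
    (by positivity) (fun e => Finset.sum_nonneg fun q _ => by positivity) (fun e he => ?_) ?_ hμ0
    (fun h => Real.exp 2 * μ < edgeSum w h ∧
      28 * (M * (M - 1)) * entropyWeight S < edgeSum w h * Real.log (edgeSum w h / μ) ∧
      28 * (M * (M - 1)) * entropyWeight T < edgeSum w h * Real.log (edgeSum w h / μ))
    (fun h hh => hh.1.le) (fun h hh => ?_)
  · refine le_trans ?_ (card_offDiag_le (hM _ (hH.card_mem_of_edgeProb_ne_zero he)))
    simp only [hw, Finset.sum_boole]
    exact_mod_cast Finset.card_filter_le _ _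
  · rw [← hH.sum_mul_meanAdjMatrix fun u v => if u ∈ S ∧ v ∈ T then (1 : ℝ) else 0]
    refine (blockSum_eq_sum_indicator (meanAdjMatrix P H) S T).symm.trans_le ?_
    calc blockSum (meanAdjMatrix P H) S T ≤ ∑ u ∈ S, ∑ v ∈ T, 2 * (M - 1) * d / n :=
          Finset.sum_le_sum fun u _ => Finset.sum_le_sum fun v _ =>
            hH.meanAdjMatrix_le hM (by omega) h2 u v
      _ = μ := by
          simp only [Finset.sum_const, nsmul_eq_mul]
          ring
  · linarith [hh.2.1, hh.2.2]

theorem IsErdosRenyi.prob_not_boundedDiscrepancy_le (hH : IsErdosRenyi P 𝓜 Q H)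
    (hM : ∀ m ∈ 𝓜, m ≤ M) (h2 : ∀ m ∈ 𝓜, 2 ≤ m) (hM2 : 2 ≤ M) (hn : 0 < n)
    (hd : 0 < dMax 𝓜 Q) :
    P.real {ω | ¬ BoundedDiscrepancy (adjMatrix (H ω)) (2 * (M - 1) * dMax 𝓜 Q / n)
      (28 * (M * (M - 1)))} ≤ (n : ℝ) ^ (-(10 : ℝ)) := by
  classical
  have hnR : (0 : ℝ) < n := by exact_mod_cast hn
  set F := (Finset.univ : Finset (Finset (Fin n))).filter Finset.Nonempty with hF
  set bad : Finset (Fin n) × Finset (Fin n) → Set Ω := fun p =>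
    {ω | ¬ (blockSum (adjMatrix (H ω)) p.1 p.2 ≤
        Real.exp 2 * (2 * (M - 1) * dMax 𝓜 Q / n * p.1.card * p.2.card) ∨
      blockSum (adjMatrix (H ω)) p.1 p.2 * Real.log (blockSum (adjMatrix (H ω)) p.1 p.2 /
        (2 * (M - 1) * dMax 𝓜 Q / n * p.1.card * p.2.card)) ≤
          28 * (M * (M - 1)) * entropyWeight p.1 ∨
      blockSum (adjMatrix (H ω)) p.1 p.2 * Real.log (blockSum (adjMatrix (H ω)) p.1 p.2 /
        (2 * (M - 1) * dMax 𝓜 Q / n * p.1.card * p.2.card)) ≤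
          28 * (M * (M - 1)) * entropyWeight p.2)} with hbad
  have hsub : {ω | ¬ BoundedDiscrepancy (adjMatrix (H ω)) (2 * (M - 1) * dMax 𝓜 Q / n)
      (28 * (M * (M - 1)))} ⊆ ⋃ p ∈ F ×ˢ F, bad p := by
    intro ω hω
    simp only [BoundedDiscrepancy, Set.mem_ofPred_eq, not_forall] at hω
    obtain ⟨S, T, hS, hT, h⟩ := hω
    simp only [Set.mem_iUnion]
    exact ⟨(S, T), by simp [hF, hS, hT], h⟩
  refine (measureReal_mono hsub (measure_ne_top _ _)).trans
    ((measureReal_biUnion_finset_le _ _).trans ?_)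
  calc ∑ p ∈ F ×ˢ F, P.real (bad p)
      ≤ ∑ p ∈ F ×ˢ F, Real.exp (-(7 * entropyWeight p.1)) * Real.exp (-(7 * entropyWeight p.2)) := by
        refine Finset.sum_le_sum fun p hp => ?_
        obtain ⟨h1, h3⟩ := Finset.mem_product.1 hp
        exact hH.prob_large_blockSum_le hM h2 hM2 hn hd (Finset.mem_filter.1 h1).2
          (Finset.mem_filter.1 h3).2
    _ = (∑ S ∈ F, Real.exp (-(7 * entropyWeight S))) *
        ∑ T ∈ F, Real.exp (-(7 * entropyWeight T)) := by
        rw [Finset.sum_product, Finset.sum_mul_sum]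
    _ ≤ (n : ℝ) ^ (-(5 : ℝ)) * (n : ℝ) ^ (-(5 : ℝ)) := by
        have := sum_exp_neg_entropy_le hn
        gcongr
    _ = (n : ℝ) ^ (-(10 : ℝ)) := by
        rw [← Real.rpow_add hnR]
        norm_num

end Discrepancy

/-! ### Norm bound for all vertex sets of moderate degree -/

/-- The numerical constants of the light and heavy parts fit into the concentration constant. -/
theorem bound_le_concConst {M : ℕ} (hM2 : 2 ≤ M) :
    16 / 9 * (7 * (M * (M - 1)) + (16 * Real.exp 2 * (2 * (M - 1)) + 2 * (8 * (11 * (M * (M - 1))) +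
      50 * (28 * (M * (M - 1))) + 48 * (2 * (M - 1)))) + 2 * (M - 1 : ℝ)) ≤ concConst M := by
  have hMR : (2 : ℝ) ≤ M := by exact_mod_cast hM2
  rw [concConst, beta0]
  generalize (M : ℝ) = m at *
  -- The left side has quadratic coefficient (16/9)(7 + 176 + 2800) < 5304; with √M ≥ 1.414 the term
  -- 2·1792(1+e^(-2))M²√M alone gives more than 5720 M².
  have hs : 1.414 ≤ √m := Real.le_sqrt_of_sq_le (by linarith)
  have he : Real.exp 2 ≤ 7.5 := by
    have h1 : Real.exp 2 = Real.exp 1 ^ 2 := by rw [← Real.exp_nat_mul]; norm_num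
    have h2 : Real.exp 1 ≤ 2.72 := by linarith [Real.exp_one_lt_d9]
    have h3 := Real.exp_pos 1
    rw [h1]
    nlinarith
  have he' : 0.13 ≤ Real.exp (-2) := by
    rw [Real.exp_neg, ← one_div, le_div_iff₀ (Real.exp_pos _)]
    linarith
  have h1 : 2 * (1792 * 1.13 * m ^ 2) * 1.414 ≤
      2 * ((16 + 32 * m * (1 + Real.exp 2) + 1792 * (1 + Real.exp (-2)) * m ^ 2) * √m + m) := by
    have h2 : 1792 * 1.13 * m ^ 2 ≤
        16 + 32 * m * (1 + Real.exp 2) + 1792 * (1 + Real.exp (-2)) * m ^ 2 := by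
      have : 0 ≤ 32 * m * (1 + Real.exp 2) := by have := Real.exp_pos 2; positivity
      nlinarith [sq_nonneg m]
    have h3 := mul_le_mul h2 hs (by norm_num) (le_trans (by positivity) h2)
    linarith
  have h4 : 16 * Real.exp 2 * (2 * (m - 1)) ≤ 240 * (m - 1) := by nlinarith
  nlinarith

section Norm

variable {n : ℕ} {Ω : Type*} [MeasurableSpace Ω] {P : Measure Ω} [IsProbabilityMeasure P]
  {𝓜 : Finset ℕ} {Q : (m : ℕ) → (Fin m → Fin n) → ℝ} {H : Ω → Hypergraph n} {M : ℕ}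

/-- The deterministic bound for the bilinear form of the regularized centred adjacency matrix. -/
theorem IsErdosRenyi.sum_regularize_le (hH : IsErdosRenyi P 𝓜 Q H) (hM : ∀ m ∈ 𝓜, m ≤ M)
    (h2 : ∀ m ∈ 𝓜, 2 ≤ m) (hM2 : 2 ≤ M) (hn : 0 < n) (hd : 0 < dMax 𝓜 Q) {ω : Ω}
    {J : Finset (Fin n)} (hJ : ∀ v ∈ J, (degree (H ω) v : ℝ) ≤ 11 * M * dMax 𝓜 Q)
    (hdisc : BoundedDiscrepancy (adjMatrix (H ω)) (2 * (M - 1) * dMax 𝓜 Q / n)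
      (28 * (M * (M - 1)))) {x y : Fin n → ℝ} (hx : ∑ u, x u ^ 2 ≤ 1) (hy : ∑ u, y u ^ 2 ≤ 1)
    {K : ℝ} (hlight : ∑ u, ∑ v, lightCoeff J (√(dMax 𝓜 Q) / n) x y u v *
      (adjMatrix (H ω) u v - meanAdjMatrix P H u v) ≤ K) :
    ∑ u, ∑ v, x u * y v *
      (regularize J (adjMatrix (H ω)) - regularize J (meanAdjMatrix P H)) u v ≤
      K + (16 * Real.exp 2 * (2 * (M - 1)) + 2 * (8 * (11 * (M * (M - 1))) +
        50 * (28 * (M * (M - 1))) + 48 * (2 * (M - 1)))) * √(dMax 𝓜 Q) +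
        2 * (M - 1) * √(dMax 𝓜 Q) := by
  set d := dMax 𝓜 Q
  set δ := √d with hδd
  have hδ : 0 < δ := Real.sqrt_pos.2 hd
  have hδ2 : δ ^ 2 = d := Real.sq_sqrt hd.le
  have hnR : (0 : ℝ) < n := by exact_mod_cast hn
  have hMR : (2 : ℝ) ≤ M := by exact_mod_cast hM2
  have hM1 : (0 : ℝ) < M - 1 := by linarith
  -- Discrepancy is known for the whole matrix but degrees are bounded only on J; cutting the
  -- vectors down to J instead of the matrix lets `heavy_sum_le` apply.
  set x' : Fin n → ℝ := fun u => if u ∈ J then x u else 0 with hx'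
  set y' : Fin n → ℝ := fun u => if u ∈ J then y u else 0 with hy'
  have hx'1 : ∑ u, x' u ^ 2 ≤ 1 := by
    refine le_trans (Finset.sum_le_sum fun u _ => ?_) hx
    simp only [hx']
    split_ifs
    · exact le_rfl
    · rw [zero_pow two_ne_zero]; positivity
  have hy'1 : ∑ u, y' u ^ 2 ≤ 1 := by
    refine le_trans (Finset.sum_le_sum fun u _ => ?_) hy
    simp only [hy']
    split_ifs
    · exact le_rfl
    · rw [zero_pow two_ne_zero]; positivity
  have hx'J : ∀ u, x' u ≠ 0 → u ∈ J := fun u hu => by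
    by_contra hcon
    exact hu (if_neg hcon)
  have hy'J : ∀ u, y' u ≠ 0 → u ∈ J := fun u hu => by
    by_contra hcon
    exact hu (if_neg hcon)
  have hdeg : ∀ u ∈ J, ∑ v, adjMatrix (H ω) u v ≤ 11 * (M * (M - 1)) * d := by
    intro u hu
    calc _ ≤ (M - 1 : ℝ) * degree (H ω) u := sum_adjMatrix_le (fun e he => hM _ (hH.card_mem ω e he)) u
      _ ≤ (M - 1 : ℝ) * (11 * M * d) := by have := hJ u hu; gcongr
      _ = _ := by ring
  have hheavy := heavy_sum_le hn (adjMatrix_nonneg (H ω)) (adjMatrix_symm (H ω)) hd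
    (by positivity) (by positivity) (by positivity) hdeg hdisc hx'1 hy'1 hx'J hy'J
  have hpt : ∀ u v, x u * y v *
      (regularize J (adjMatrix (H ω)) - regularize J (meanAdjMatrix P H)) u v ≤
      lightCoeff J (δ / n) x y u v * (adjMatrix (H ω) u v - meanAdjMatrix P H u v) +
      (if δ / n < |x' u * y' v| then |x' u * y' v| * adjMatrix (H ω) u v else 0) +
      2 * (M - 1) * δ * (x u ^ 2 * y v ^ 2) := by
    intro u v
    have hA := adjMatrix_nonneg (H ω) u v
    have hm0 := hH.meanAdjMatrix_nonneg u v
    have hm1 := hH.meanAdjMatrix_le hM (by omega) h2 u v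
    change _ * ((if u ∈ J ∧ v ∈ J then adjMatrix (H ω) u v else 0) -
      (if u ∈ J ∧ v ∈ J then meanAdjMatrix P H u v else 0)) ≤ _
    generalize adjMatrix (H ω) u v = a at *
    generalize meanAdjMatrix P H u v = b at *
    have hsq : 0 ≤ 2 * (M - 1) * δ * (x u ^ 2 * y v ^ 2) := by positivity
    by_cases huv : u ∈ J ∧ v ∈ J
    · simp only [lightCoeff, hx', hy', huv, and_self, true_and, if_true]
      by_cases hl : |x u * y v| ≤ δ / n
      · rw [if_pos hl, if_neg (not_lt.2 hl)]
        linarith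
      · rw [if_neg hl, if_pos (not_le.1 hl)]
        rw [not_le, div_lt_iff₀ hnR] at hl
        have h1 : x u * y v * a ≤ |x u * y v| * a :=
          mul_le_mul_of_nonneg_right (le_abs_self _) hA
        have h3 : -(x u * y v * b) ≤ |x u * y v| * b := by
          rw [← neg_mul]
          exact mul_le_mul_of_nonneg_right (neg_le_abs _) hm0
        -- A heavy pair has δ < n|x_u y_v|, so d = δ² in the mean bound turns into δ n|x_u y_v| and
        -- the sum is controlled by ‖x‖²‖y‖².
        have h4 : |x u * y v| * b ≤ 2 * (M - 1) * δ * (x u ^ 2 * y v ^ 2) := by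
          calc |x u * y v| * b ≤ |x u * y v| * (2 * (M - 1) * d / n) := by gcongr
            _ = |x u * y v| * (2 * (M - 1) * δ / n) * δ := by rw [← hδ2]; ring
            _ ≤ |x u * y v| * (2 * (M - 1) * δ / n) * (|x u * y v| * n) := by gcongr
            _ = 2 * (M - 1) * δ * |x u * y v| ^ 2 := by field_simp
            _ = _ := by rw [sq_abs, mul_pow]
        linarith
    · have h0 : lightCoeff J (δ / n) x y u v = 0 := if_neg fun h => huv h.1
      rw [h0, if_neg huv, if_neg huv]
      have h5 : 0 ≤ if δ / n < |x' u * y' v| then |x' u * y' v| * a else 0 := by positivity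
      linarith
  have hxy : ∑ u, ∑ v, 2 * (M - 1) * δ * (x u ^ 2 * y v ^ 2) ≤ 2 * (M - 1) * δ := by
    simp only [← Finset.mul_sum]
    rw [← Finset.sum_mul]
    have h0 : 0 ≤ ∑ v, y v ^ 2 := Finset.sum_nonneg fun _ _ => sq_nonneg _
    calc _ ≤ 2 * (M - 1) * δ * (1 * 1) := by gcongr
      _ = _ := by ring
  have hsum := Finset.sum_le_sum fun u (_ : u ∈ (Finset.univ : Finset (Fin n))) =>
    Finset.sum_le_sum fun v (_ : v ∈ (Finset.univ : Finset (Fin n))) => hpt u v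
  simp only [Finset.sum_add_distrib] at hsum
  linarith

/-- The regularized matrices concentrate for every set of vertices of moderate degree. -/
def ConcentratesOnModerate {n : ℕ} {Ω : Type*} [MeasurableSpace Ω] (P : Measure Ω)
    (H : Ω → Hypergraph n) (M : ℕ) (d : ℝ) (ω : Ω) : Prop :=
  ∀ J : Finset (Fin n), (∀ v ∈ J, (degree (H ω) v : ℝ) ≤ 11 * M * d) →
    opNorm (regularize J (adjMatrix (H ω)) - regularize J (meanAdjMatrix P H)) ≤
      concConst M * √d

/-- The tilts and levels need d > 0. If d = 0, degrees on J vanish and so do the mean entries: both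
regularized matrices are zero. -/
theorem IsErdosRenyi.concentratesOnModerate_of_dMax_eq_zero (hH : IsErdosRenyi P 𝓜 Q H)
    (hM : ∀ m ∈ 𝓜, m ≤ M) (h2 : ∀ m ∈ 𝓜, 2 ≤ m) (hM2 : 2 ≤ M) (hd : dMax 𝓜 Q = 0) (ω : Ω) :
    ConcentratesOnModerate P H M (dMax 𝓜 Q) ω := by
  intro J hJ
  rw [hd] at hJ ⊢
  have hz : regularize J (adjMatrix (H ω)) - regularize J (meanAdjMatrix P H) = 0 := by
    ext u v
    change ((if u ∈ J ∧ v ∈ J then adjMatrix (H ω) u v else 0) -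
      (if u ∈ J ∧ v ∈ J then meanAdjMatrix P H u v else 0)) = 0
    split_ifs with huv
    · have hm0 := hH.meanAdjMatrix_nonneg u v
      have hm1 := hH.meanAdjMatrix_le hM (by omega) h2 u v
      rw [hd, mul_zero, zero_div] at hm1
      have h1 := sum_adjMatrix_le (h := H ω) (fun e he => hM _ (hH.card_mem ω e he)) u
      have h3 := hJ u huv.1
      have h4 : (degree (H ω) u : ℝ) = 0 :=
        le_antisymm (by linarith) (Nat.cast_nonneg _)
      rw [h4, mul_zero] at h1
      have h5 := Finset.single_le_sum (f := fun v => adjMatrix (H ω) u v)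
        (fun v _ => adjMatrix_nonneg (H ω) u v) (Finset.mem_univ v)
      have h6 := adjMatrix_nonneg (H ω) u v
      linarith
    · simp
  rw [hz, opNorm, map_zero, norm_zero, Real.sqrt_zero, mul_zero]

theorem IsErdosRenyi.prob_not_concentratesOnModerate_le (hH : IsErdosRenyi P 𝓜 Q H)
    (hM : ∀ m ∈ 𝓜, m ≤ M) (h2 : ∀ m ∈ 𝓜, 2 ≤ m) (hM2 : 2 ≤ M) (hn : 0 < n) :
    P.real {ω | ¬ ConcentratesOnModerate P H M (dMax 𝓜 Q) ω} ≤
      (Real.exp 1 / 2) ^ (-(n : ℝ)) + (n : ℝ) ^ (-(10 : ℝ)) := by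
  rcases hH.dMax_nonneg.eq_or_lt with hd | hd
  · have : {ω | ¬ ConcentratesOnModerate P H M (dMax 𝓜 Q) ω} = ∅ := by
      ext ω
      simpa using hH.concentratesOnModerate_of_dMax_eq_zero hM h2 hM2 hd.symm ω
    rw [this, measureReal_empty]
    have := Real.exp_pos 1
    positivity
  obtain ⟨N, hNcard, hN1, hN⟩ := exists_finite_net n
  have hsub : {ω | ¬ ConcentratesOnModerate P H M (dMax 𝓜 Q) ω} ⊆
      {ω | ¬ LightBound N (fun u v => adjMatrix (H ω) u v - meanAdjMatrix P H u v)
        (√(dMax 𝓜 Q) / n) (7 * (M * (M - 1)) * √(dMax 𝓜 Q))} ∪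
      {ω | ¬ BoundedDiscrepancy (adjMatrix (H ω)) (2 * (M - 1) * dMax 𝓜 Q / n)
        (28 * (M * (M - 1)))} := by
    intro ω hω
    by_contra hcon
    simp only [Set.mem_union, Set.mem_ofPred_eq, not_or, not_not] at hcon
    refine hω fun J hJ => ?_
    have hMR : (2 : ℝ) ≤ M := by exact_mod_cast hM2
    have hM1 : (0 : ℝ) ≤ M - 1 := by linarith
    have hδ := Real.sqrt_nonneg (dMax 𝓜 Q)
    have hE := Real.exp_pos 2
    have hop := hN _ ((7 * (M * (M - 1)) * √(dMax 𝓜 Q)) +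
      (16 * Real.exp 2 * (2 * (M - 1)) + 2 * (8 * (11 * (M * (M - 1))) +
        50 * (28 * (M * (M - 1))) + 48 * (2 * (M - 1)))) * √(dMax 𝓜 Q) +
        2 * (M - 1) * √(dMax 𝓜 Q)) (by positivity)
      fun x hx y hy => hH.sum_regularize_le hM h2 hM2 hn hd hJ hcon.2 (hN1 x hx) (hN1 y hy)
        (hcon.1 J x hx y hy)
    refine hop.trans ?_
    have := mul_le_mul_of_nonneg_right (bound_le_concConst hM2) hδ
    linarith
  calc _ ≤ _ := measureReal_mono hsub (measure_ne_top _ _)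
    _ ≤ _ := measureReal_union_le _ _
    _ ≤ _ := add_le_add (hH.prob_not_lightBound_le hM h2 hM2 hn hd hNcard hN1)
        (hH.prob_not_boundedDiscrepancy_le hM h2 hM2 hn hd)

end Norm

/-! ### Degrees after trimming -/

/-- If a vertex survives the trimming, then more than `n exp (-d̄)` vertices have at least its
degree. -/
theorem IsTopDegreeTrimming.lt_card {n : ℕ} {h : Hypergraph n} {J : Finset (Fin n)}
    (hJ : IsTopDegreeTrimming h J) {v : Fin n} (hv : v ∈ J) :
    (n : ℝ) * Real.exp (-avgDegree h) <
      ((Finset.univ.filter fun u => degree h v ≤ degree h u).card : ℝ) := by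
  have hsub : insert v Jᶜ ⊆ Finset.univ.filter fun u => degree h v ≤ degree h u := by
    intro u hu
    rcases Finset.mem_insert.1 hu with rfl | hu
    · simp
    · exact Finset.mem_filter.2 ⟨Finset.mem_univ _, hJ.2 v hv u (Finset.mem_compl.1 hu)⟩
  have hcard := Finset.card_le_card hsub
  rw [Finset.card_insert_of_notMem (by simpa using hv), hJ.1] at hcard
  -- The survivor itself, added to the ⌊n e^(-d̄)⌋ removed vertices, makes the inequality strict.
  have h1 := Nat.lt_floor_add_one ((n : ℝ) * Real.exp (-avgDegree h))
  refine h1.trans_le ?_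
  exact_mod_cast hcard

/-- In a hypergraph of average degree at most `1 / 2`, only isolated vertices survive. -/
theorem IsTopDegreeTrimming.degree_eq_zero {n : ℕ} {h : Hypergraph n} {J : Finset (Fin n)}
    (hJ : IsTopDegreeTrimming h J) (hd : avgDegree h ≤ 1 / 2) {v : Fin n} (hv : v ∈ J) :
    degree h v = 0 := by
  by_contra hne
  have hn : (0 : ℝ) < n := by exact_mod_cast v.pos
  have h1 := hJ.lt_card hv
  have h2 : ((Finset.univ.filter fun u => degree h v ≤ degree h u).card : ℝ) ≤
      ∑ u, (degree h u : ℝ) := by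
    rw [Finset.card_filter, Nat.cast_sum]
    refine Finset.sum_le_sum fun u _ => ?_
    split_ifs with hu
    · have : 1 ≤ degree h u := by omega
      exact_mod_cast this
    · simp
  have h3 : ∑ u, (degree h u : ℝ) = n * avgDegree h := by rw [avgDegree]; field_simp
  -- A survivor of positive degree would give n d̄ > n e^(-d̄) ≥ n(1 - d̄), so d̄ > 1/2.
  have h4 := Real.add_one_le_exp (-avgDegree h)
  rw [h3] at h2
  have h5 := lt_of_mul_lt_mul_left (h1.trans_le h2) hn.le
  linarith

theorem sum_degree_eq_edgeSum {n : ℕ} (h : Hypergraph n) (S : Finset (Fin n)) :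
    ∑ v ∈ S, (degree h v : ℝ) = edgeSum (fun e => ((S ∩ e).card : ℝ)) h := by
  simp only [degree_eq_edgeSum, edgeSum]
  rw [Finset.sum_comm]
  refine Finset.sum_congr rfl fun e _ => ?_
  rw [Finset.sum_boole, Finset.filter_mem_eq_inter]

theorem IsErdosRenyi.sum_inter_card_mul_edgeProb_le {n : ℕ} {Ω : Type*} [MeasurableSpace Ω]
    {P : Measure Ω} {𝓜 : Finset ℕ} {Q : (m : ℕ) → (Fin m → Fin n) → ℝ} {H : Ω → Hypergraph n}
    (hH : IsErdosRenyi P 𝓜 Q H)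
    (S : Finset (Fin n)) :
    ∑ e, ((S ∩ e).card : ℝ) * edgeProb P H e ≤ dMax 𝓜 Q * S.card := by
  have h1 : ∀ e : Finset (Fin n), ((S ∩ e).card : ℝ) * edgeProb P H e =
      ∑ v ∈ S, if v ∈ e then edgeProb P H e else 0 := by
    intro e
    rw [← Finset.sum_filter, Finset.filter_mem_eq_inter, Finset.sum_const, nsmul_eq_mul]
  simp only [h1]
  rw [Finset.sum_comm]
  calc _ ≤ ∑ v ∈ S, dMax 𝓜 Q := by
        refine Finset.sum_le_sum fun v _ => ?_
        rw [← Finset.sum_filter]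
        exact hH.sum_mem_edgeProb_le v
    _ = _ := by rw [Finset.sum_const, nsmul_eq_mul, mul_comm]

section Trimming

variable {n : ℕ} {Ω : Type*} [MeasurableSpace Ω] {P : Measure Ω} [IsProbabilityMeasure P]
  {𝓜 : Finset ℕ} {Q : (m : ℕ) → (Fin m → Fin n) → ℝ} {H : Ω → Hypergraph n} {M : ℕ}

/-- A hyperedge contributes |S ∩ e| ≤ M to the degree sum over S, so Chernoff applies with maximal
weight M. -/
theorem IsErdosRenyi.prob_sum_degree_ge_le (hH : IsErdosRenyi P 𝓜 Q H) (hM : ∀ m ∈ 𝓜, m ≤ M)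
    (hM2 : 0 < M) (S : Finset (Fin n)) {μ k : ℝ}
    (hμ : ∑ e, ((S ∩ e).card : ℝ) * edgeProb P H e ≤ μ) (hk : 1 ≤ k) :
    P.real {ω | k * μ ≤ ∑ v ∈ S, (degree (H ω) v : ℝ)} ≤
      Real.exp (-(μ / M) * (k * Real.log k - k + 1)) := by
  simp only [sum_degree_eq_edgeSum]
  refine chernoff_edgeSum hH.measurableSet hH.indep (by exact_mod_cast hM2)
    (fun e => Nat.cast_nonneg _) (fun e he => ?_) hμ hk
  have h1 := hM _ (hH.card_mem_of_edgeProb_ne_zero he)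
  exact_mod_cast (Finset.card_le_card Finset.inter_subset_right).trans h1

/-- It is unlikely that many vertices have a large degree. -/
theorem IsErdosRenyi.prob_many_large_degrees_le (hH : IsErdosRenyi P 𝓜 Q H)
    (hM : ∀ m ∈ 𝓜, m ≤ M) (hM2 : 2 ≤ M) {ξ : ℝ} (hξ : 1 / 8 ≤ ξ)
    (hξd : ξ ≤ dMax 𝓜 Q) {s : ℕ} (hs : 0 < s) (hns : n * Real.exp (-(2 * ξ)) ≤ s) :
    P.real {ω | ∃ S : Finset (Fin n), S.card = s ∧
      11 * M * (dMax 𝓜 Q * s) ≤ ∑ v ∈ S, (degree (H ω) v : ℝ)} ≤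
      Real.exp (-(dMax 𝓜 Q * s)) := by
  classical
  set d := dMax 𝓜 Q
  have hsR : (0 : ℝ) < s := by exact_mod_cast hs
  have hMR : (2 : ℝ) ≤ M := by exact_mod_cast hM2
  have hd : 1 / 8 ≤ d := hξ.trans hξd
  have hsub : {ω | ∃ S : Finset (Fin n), S.card = s ∧
      11 * M * (d * s) ≤ ∑ v ∈ S, (degree (H ω) v : ℝ)} ⊆
      ⋃ S ∈ Finset.powersetCard s (Finset.univ : Finset (Fin n)),
        {ω | 11 * M * (d * s) ≤ ∑ v ∈ S, (degree (H ω) v : ℝ)} := by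
    rintro ω ⟨S, hS, h⟩
    simp only [Set.mem_iUnion]
    exact ⟨S, Finset.mem_powersetCard.2 ⟨Finset.subset_univ _, hS⟩, h⟩
  have hone : ∀ S ∈ Finset.powersetCard s (Finset.univ : Finset (Fin n)),
      P.real {ω | 11 * M * (d * s) ≤ ∑ v ∈ S, (degree (H ω) v : ℝ)} ≤
        Real.exp (-(11 * (d * s))) := by
    intro S hS
    have hcard := (Finset.mem_powersetCard.1 hS).2
    have hμ := hH.sum_inter_card_mul_edgeProb_le S
    rw [hcard] at hμ
    refine (hH.prob_sum_degree_ge_le hM (by omega) S hμ (by linarith)).trans ?_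
    rw [Real.exp_le_exp]
    -- With k = 11M, log k ≥ 2 gives k log k - k + 1 ≥ k, hence the exponent (ds/M)·11M = 11ds.
    have hlog : 2 ≤ Real.log (11 * M) := by
      rw [Real.le_log_iff_exp_le (by linarith)]
      have h1 : Real.exp 2 = Real.exp 1 ^ 2 := by rw [← Real.exp_nat_mul]; norm_num
      have h2 : Real.exp 1 ≤ 3 := by linarith [Real.exp_one_lt_d9]
      have h3 := Real.exp_pos 1
      rw [h1]
      nlinarith
    have h4 : 11 * (M : ℝ) ≤ 11 * M * Real.log (11 * M) - 11 * M + 1 := by nlinarith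
    have h5 := mul_le_mul_of_nonneg_left h4 (show 0 ≤ d * s / M by positivity)
    have h6 : d * s / M * (11 * M) = 11 * (d * s) := by field_simp
    linarith
  have hcount : ((Finset.powersetCard s (Finset.univ : Finset (Fin n))).card : ℝ) ≤
      Real.exp (10 * (d * s)) := by
    rw [Finset.card_powersetCard, Finset.card_univ, Fintype.card_fin]
    refine (choose_le_exp_entropy hs).trans ?_
    rw [Real.exp_le_exp]
    have h1 : Real.exp 1 * n / s ≤ Real.exp (1 + 2 * ξ) := by
      rw [div_le_iff₀ hsR, Real.exp_add, mul_assoc]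
      gcongr
      rw [Real.exp_neg, ← div_eq_mul_inv, div_le_iff₀ (Real.exp_pos _)] at hns
      linarith
    -- The number of candidate sets costs 1 + 2ξ ≤ 8d + 2d per vertex, since 1/8 ≤ ξ ≤ d; one unit
    -- of the 11 is left.
    have h2 : Real.log (Real.exp 1 * n / s) ≤ 10 * d := by
      rcases (by positivity : 0 ≤ Real.exp 1 * n / s).eq_or_lt with h0 | h0
      · rw [← h0, Real.log_zero]; linarith
      · have := Real.log_le_log h0 h1
        rw [Real.log_exp] at this
        linarith
    calc s * Real.log (Real.exp 1 * n / s) ≤ s * (10 * d) := by gcongr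
      _ = _ := by ring
  calc _ ≤ _ := measureReal_mono hsub (measure_ne_top _ _)
    _ ≤ _ := measureReal_biUnion_finset_le _ _
    _ ≤ ((Finset.powersetCard s (Finset.univ : Finset (Fin n))).card : ℝ) *
        Real.exp (-(11 * (d * s))) := by
        simpa using Finset.sum_le_card_nsmul _ _ _ hone
    _ ≤ Real.exp (10 * (d * s)) * Real.exp (-(11 * (d * s))) := by gcongr
    _ = _ := by rw [← Real.exp_add]; congr 1; ring

/-- The trimmed hypergraph has moderate degrees. -/
def TrimmingModerate {n : ℕ} (h : Hypergraph n) (b : ℝ) : Prop :=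
  ∀ J, IsTopDegreeTrimming h J → ∀ v ∈ J, (degree h v : ℝ) ≤ b

/-- If 4ξ ≤ log n, then s ≥ n e^(-2ξ) ≥ √n, and √n/8 ≥ log n/16. Otherwise ds ≥ ξ > log n/4 already.
-/
theorem exp_neg_le_rpow {n : ℕ} (hn : 0 < n) {d ξ s : ℝ} (hξ : 1 / 8 ≤ ξ) (hξd : ξ ≤ d)
    (hs : 1 ≤ s) (hns : n * Real.exp (-(2 * ξ)) ≤ s) :
    Real.exp (-(d * s)) ≤ (n : ℝ) ^ (-(1 / 16) : ℝ) := by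
  have hnR : (0 : ℝ) < n := by exact_mod_cast hn
  rw [Real.rpow_def_of_pos hnR, Real.exp_le_exp]
  suffices Real.log n / 16 ≤ d * s by linarith
  have hds : ξ * s ≤ d * s := by gcongr
  refine le_trans ?_ hds
  by_cases h : 4 * ξ ≤ Real.log n
  · have h1 : √n ≤ s := by
      refine le_trans ?_ hns
      have h2 : √(n : ℝ) = Real.exp (Real.log n / 2) := by
        rw [Real.sqrt_eq_rpow, Real.rpow_def_of_pos hnR]
        congr 1
        ring
      have h3 : (n : ℝ) = Real.exp (Real.log n) := (Real.exp_log hnR).symm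
      rw [h2]
      nth_rw 2 [h3]
      rw [← Real.exp_add, Real.exp_le_exp]
      linarith
    have h4 : Real.log n ≤ 2 * √n := by
      have h5 := Real.log_le_sub_one_of_pos (Real.sqrt_pos.2 hnR)
      rw [Real.log_sqrt hnR.le] at h5
      linarith
    have h6 : 1 / 8 * √n ≤ ξ * s := by gcongr
    linarith
  · have : ξ * 1 ≤ ξ * s := by gcongr
    linarith

/-- The sum of all degrees is unlikely to exceed twice its mean, or `n / 4`. -/
theorem IsErdosRenyi.prob_sum_degree_large_le (hH : IsErdosRenyi P 𝓜 Q H)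
    (hM : ∀ m ∈ 𝓜, m ≤ M) (hM2 : 2 ≤ M) (hn : 0 < n) {ξ : ℝ} (hξ : 1 / 8 ≤ ξ)
    (hm : ∑ e, (((Finset.univ : Finset (Fin n)) ∩ e).card : ℝ) * edgeProb P H e ≤ ξ * n) :
    P.real {ω | 2 * (ξ * n) ≤ ∑ v, (degree (H ω) v : ℝ)} ≤
      24 * M * (n : ℝ) ^ (-(1 / 16) : ℝ) := by
  refine (hH.prob_sum_degree_ge_le hM (by omega) Finset.univ hm one_le_two).trans ?_
  have hnR : (1 : ℝ) ≤ n := by exact_mod_cast hn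
  have hMR : (2 : ℝ) ≤ M := by exact_mod_cast hM2
  clear hm hM
  have hlog : (0.38 : ℝ) ≤ 2 * Real.log 2 - 2 + 1 := by linarith [Real.log_two_gt_d9]
  generalize 2 * Real.log 2 - 2 + 1 = l at *
  have h1 : (n : ℝ) / (24 * M) ≤ ξ * n / M * l := by
    calc (n : ℝ) / (24 * M) = 1 / 24 * (n / M) := by field_simp
      _ ≤ 1 / 8 * (n / M) * 0.38 := by
          have : 0 ≤ (n : ℝ) / M := by positivity
          linarith
      _ ≤ ξ * (n / M) * l := by gcongr
      _ = _ := by ring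
  have hx : 0 < (n : ℝ) / (24 * M) := by positivity
  have h2 := Real.add_one_le_exp ((n : ℝ) / (24 * M))
  calc Real.exp (-(ξ * n / M) * l) ≤ Real.exp (-((n : ℝ) / (24 * M))) := by
        rw [Real.exp_le_exp]; linarith
    _ ≤ ((n : ℝ) / (24 * M))⁻¹ := by
        rw [Real.exp_neg]
        exact inv_anti₀ hx (by linarith)
    _ = 24 * M * (n : ℝ) ^ (-1 : ℝ) := by rw [Real.rpow_neg_one, inv_div, div_eq_mul_inv]
    _ ≤ 24 * M * (n : ℝ) ^ (-(1 / 16) : ℝ) := by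
        have := Real.rpow_le_rpow_of_exponent_le hnR (show (-1 : ℝ) ≤ -(1 / 16) by norm_num)
        gcongr

theorem IsErdosRenyi.prob_not_trimmingModerate_le (hH : IsErdosRenyi P 𝓜 Q H)
    (hM : ∀ m ∈ 𝓜, m ≤ M) (hM2 : 2 ≤ M) (hn : 0 < n) :
    P.real {ω | ¬ TrimmingModerate (H ω) (11 * M * dMax 𝓜 Q)} ≤
      (24 * M + 1) * (n : ℝ) ^ (-(1 / 16) : ℝ) := by
  classical
  set d := dMax 𝓜 Q
  have hd0 : 0 ≤ d := hH.dMax_nonneg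
  have hnR : (1 : ℝ) ≤ n := by exact_mod_cast hn
  have hMR : (2 : ℝ) ≤ M := by exact_mod_cast hM2
  set m := ∑ e, (((Finset.univ : Finset (Fin n)) ∩ e).card : ℝ) * edgeProb P H e with hm
  have hmd : m ≤ d * n := by
    have h := hH.sum_inter_card_mul_edgeProb_le Finset.univ
    rwa [Finset.card_univ, Fintype.card_fin] at h
  -- The floor 1/8 keeps the Chernoff exponent linear in n. When it is active, d̄ ≤ 1/4 typically
  -- and survivors are isolated; otherwise ξ ≤ d and large degrees are counted.
  set ξ := max (m / n) (1 / 8) with hξ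
  have hξ8 : 1 / 8 ≤ ξ := le_max_right _ _
  have hmξ : m ≤ ξ * n := by
    rw [← div_le_iff₀ (by linarith)]
    exact le_max_left _ _
  have havg := hH.prob_sum_degree_large_le hM hM2 hn hξ8 hmξ
  have havgdeg : ∀ ω, ¬ 2 * (ξ * n) ≤ ∑ v, (degree (H ω) v : ℝ) → avgDegree (H ω) ≤ 2 * ξ := by
    intro ω hω
    rw [avgDegree, div_le_iff₀ (by linarith)]
    linarith
  rcases lt_or_ge (m / n) (1 / 8) with hcase | hcase
  · have hξe : ξ = 1 / 8 := max_eq_right hcase.le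
    have hsub : {ω | ¬ TrimmingModerate (H ω) (11 * M * d)} ⊆
        {ω | 2 * (ξ * n) ≤ ∑ v, (degree (H ω) v : ℝ)} := by
      intro ω hω
      by_contra hcon
      refine hω fun J hJ v hv => ?_
      have h1 := havgdeg ω hcon
      rw [hJ.degree_eq_zero (by rw [hξe] at h1; linarith) hv, Nat.cast_zero]
      positivity
    refine (measureReal_mono hsub (measure_ne_top _ _)).trans (havg.trans ?_)
    have : 0 ≤ (n : ℝ) ^ (-(1 / 16) : ℝ) := by positivity
    linarith
  · have hξe : ξ = m / n := max_eq_left hcase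
    have hξd : ξ ≤ d := by rw [hξe, div_le_iff₀ (by linarith)]; exact hmd
    set s := ⌈(n : ℝ) * Real.exp (-(2 * ξ))⌉₊ with hs
    have hs0 : 0 < s := Nat.ceil_pos.2 (by positivity)
    have hns : (n : ℝ) * Real.exp (-(2 * ξ)) ≤ s := Nat.le_ceil _
    have hsub : {ω | ¬ TrimmingModerate (H ω) (11 * M * d)} ⊆
        {ω | 2 * (ξ * n) ≤ ∑ v, (degree (H ω) v : ℝ)} ∪
        {ω | ∃ S : Finset (Fin n), S.card = s ∧
          11 * M * (d * s) ≤ ∑ v ∈ S, (degree (H ω) v : ℝ)} := by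
      intro ω hω
      by_contra hcon
      rw [Set.mem_union, not_or] at hcon
      refine hω fun J hJ v hv => ?_
      by_contra hlarge
      rw [not_le] at hlarge
      refine hcon.2 ?_
      have h1 := havgdeg ω hcon.1
      have h2 : s ≤ (Finset.univ.filter fun u => degree (H ω) v ≤ degree (H ω) u).card := by
        rw [hs, Nat.ceil_le]
        refine le_trans ?_ (hJ.lt_card hv).le
        gcongr
      obtain ⟨S, hS, hScard⟩ := Finset.exists_subset_card_eq h2
      refine ⟨S, hScard, ?_⟩
      have h3 : ∑ u ∈ S, (11 * M * d) ≤ ∑ u ∈ S, (degree (H ω) u : ℝ) := by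
        refine Finset.sum_le_sum fun u hu => hlarge.le.trans ?_
        exact_mod_cast (Finset.mem_filter.1 (hS hu)).2
      rw [Finset.sum_const, hScard, nsmul_eq_mul] at h3
      linarith
    calc _ ≤ _ := measureReal_mono hsub (measure_ne_top _ _)
      _ ≤ _ := measureReal_union_le _ _
      _ ≤ 24 * M * (n : ℝ) ^ (-(1 / 16) : ℝ) + (n : ℝ) ^ (-(1 / 16) : ℝ) :=
          add_le_add havg ((hH.prob_many_large_degrees_le hM hM2 hξ8 hξd hs0 hns).trans
            (exp_neg_le_rpow hn hξ8 hξd (by exact_mod_cast hs0) hns))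
      _ = _ := by ring

end Trimming

/-! ### Rates and the final union bounds -/

/-- A polynomial rate with a large constant is a slower polynomial rate, or trivial. -/
theorem exists_rate (B : ℝ) (hB : 2 ≤ B) : ∃ c : ℝ, 0 < c ∧ ∀ n : ℕ, 1 ≤ n →
    1 ≤ 2 * (n : ℝ) ^ (-c) ∨ B * (n : ℝ) ^ (-(1 / 16) : ℝ) ≤ 2 * (n : ℝ) ^ (-c) := by
  have hlogB : Real.log 2 ≤ Real.log B := Real.log_le_log two_pos hB
  have hlog2 : 0 < Real.log 2 := Real.log_pos one_lt_two
  have hlogB0 : 0 < Real.log B := by linarith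
  -- While log n ≤ 32 log B, this c gives n^(-c) ≥ 1/2 and the first alternative. Beyond, B
  -- n^(-1/16) ≤ n^(-1/32) ≤ n^(-c).
  refine ⟨Real.log 2 / (32 * Real.log B), by positivity, fun n hn => ?_⟩
  have hnR : (1 : ℝ) ≤ n := by exact_mod_cast hn
  have hn0 : (0 : ℝ) < n := by linarith
  have hlogn : 0 ≤ Real.log n := Real.log_nonneg hnR
  have hc : Real.log 2 / (32 * Real.log B) ≤ 1 / 32 := by
    rw [div_le_iff₀ (by positivity)]
    linarith
  rw [Real.rpow_def_of_pos hn0, Real.rpow_def_of_pos hn0]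
  rcases le_total (Real.log n) (32 * Real.log B) with h | h
  · left
    have h1 : Real.log n * (Real.log 2 / (32 * Real.log B)) ≤ Real.log 2 := by
      calc _ ≤ 32 * Real.log B * (Real.log 2 / (32 * Real.log B)) := by gcongr
        _ = Real.log 2 := by field_simp
    have h2 : Real.exp (-Real.log 2) ≤
        Real.exp (Real.log n * -(Real.log 2 / (32 * Real.log B))) := by
      rw [Real.exp_le_exp]; linarith
    rw [Real.exp_neg, Real.exp_log two_pos] at h2
    linarith
  · right
    have h1 : Real.log n * (Real.log 2 / (32 * Real.log B)) ≤ Real.log n * (1 / 32) := by gcongr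
    have h2 : B * Real.exp (Real.log n * (-(1 / 16))) ≤
        Real.exp (Real.log n * -(Real.log 2 / (32 * Real.log B))) := by
      nth_rw 1 [← Real.exp_log (show 0 < B by linarith)]
      rw [← Real.exp_add, Real.exp_le_exp]
      linarith
    have h3 := Real.exp_pos (Real.log n * -(Real.log 2 / (32 * Real.log B)))
    linarith

/-- Complementary form of a union bound. -/
theorem one_sub_measureReal_le {Ω : Type*} [MeasurableSpace Ω] (P : Measure Ω)
    [IsProbabilityMeasure P] {s t : Set Ω} (h : sᶜ ⊆ t) : 1 - P.real s ≤ P.real t := by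
  have h1 : (Set.univ : Set Ω) ⊆ s ∪ t := fun ω _ => by
    by_cases hω : ω ∈ s
    · exact Or.inl hω
    · exact Or.inr (h hω)
  have h2 := (measureReal_mono h1 (measure_ne_top P _)).trans (measureReal_union_le s t)
  rw [probReal_univ] at h2
  linarith

end NonUniformHypergraph

theorem theorem3 (𝓜 : Finset ℕ) (h𝓜 : 𝓜.Nonempty) (h2 : ∀ m ∈ 𝓜, 2 ≤ m) :
    (∀ κ : ℝ, 0 < κ → ∃ c : ℝ, 0 < c ∧
      ∀ (n : ℕ), 1 ≤ n → ∀ (Q : (m : ℕ) → (Fin m → Fin n) → ℝ)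
        (Ω : Type*) [MeasurableSpace Ω] (P : Measure Ω) [IsProbabilityMeasure P]
        (H : Ω → Hypergraph n), IsErdosRenyi P 𝓜 Q H →
        κ ≤ zeta P H * Real.log (zeta P H / gamma P H) →
        1 - 2 * (Real.exp 1 / 2) ^ (-(n : ℝ)) - 2 * (n : ℝ) ^ (-c) ≤
          P.real {ω | ∀ J : Finset (Fin n), IsTopDegreeTrimming (H ω) J →
            opNorm (regularize J (adjMatrix (H ω)) - regularize J (meanAdjMatrix P H)) ≤
              concConst (𝓜.max' h𝓜 : ℝ) * Real.sqrt (dMax 𝓜 Q)}) ∧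
    (∀ (n : ℕ), 1 ≤ n → ∀ (Q : (m : ℕ) → (Fin m → Fin n) → ℝ)
        (Ω : Type*) [MeasurableSpace Ω] (P : Measure Ω) [IsProbabilityMeasure P]
        (H : Ω → Hypergraph n), IsErdosRenyi P 𝓜 Q H →
        1 - 2 * (Real.exp 1 / 2) ^ (-(n : ℝ)) - (n : ℝ) ^ (-(10 : ℝ)) ≤
          P.real {ω |
            opNorm (regularize (lowDegree (H ω) ((𝓜.max' h𝓜 : ℝ) * dMax 𝓜 Q)) (adjMatrix (H ω)) -
                regularize (lowDegree (H ω) ((𝓜.max' h𝓜 : ℝ) * dMax 𝓜 Q)) (meanAdjMatrix P H)) ≤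
              concConst (𝓜.max' h𝓜 : ℝ) * Real.sqrt (dMax 𝓜 Q)}) := by
  have hM : ∀ m ∈ 𝓜, m ≤ 𝓜.max' h𝓜 := fun m hm => 𝓜.le_max' m hm
  have hM2 : 2 ≤ 𝓜.max' h𝓜 := h2 _ (𝓜.max'_mem h𝓜)
  generalize 𝓜.max' h𝓜 = M at *
  have hMR : (2 : ℝ) ≤ M := by exact_mod_cast hM2
  have he := Real.exp_pos 1
  constructor
  · intro κ _
    -- 24M + 1 comes from the trimming, and one more from n^(-10) ≤ n^(-1/16).
    obtain ⟨c, hc, hrate⟩ := exists_rate (24 * M + 2) (by linarith)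
    refine ⟨c, hc, fun n hn Q Ω _ P _ H hH _ => ?_⟩
    have hnR : (1 : ℝ) ≤ n := by exact_mod_cast hn
    have h0 : 0 ≤ (Real.exp 1 / 2) ^ (-(n : ℝ)) := by positivity
    rcases hrate n hn with h1 | h1
    · refine le_trans ?_ measureReal_nonneg
      linarith
    have hbad := hH.prob_not_concentratesOnModerate_le hM h2 hM2 hn
    have htrim := hH.prob_not_trimmingModerate_le hM hM2 hn
    have hpow : (n : ℝ) ^ (-(10 : ℝ)) ≤ (n : ℝ) ^ (-(1 / 16) : ℝ) :=
      Real.rpow_le_rpow_of_exponent_le hnR (by norm_num)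
    have hunion := measureReal_union_le (μ := P)
      {ω | ¬ ConcentratesOnModerate P H M (dMax 𝓜 Q) ω}
      {ω | ¬ TrimmingModerate (H ω) (11 * M * dMax 𝓜 Q)}
    refine le_trans ?_ (one_sub_measureReal_le P
      (s := {ω | ¬ ConcentratesOnModerate P H M (dMax 𝓜 Q) ω} ∪
        {ω | ¬ TrimmingModerate (H ω) (11 * M * dMax 𝓜 Q)}) ?_)
    · linarith
    · intro ω hω J hJ
      rw [Set.mem_compl_iff, Set.mem_union, not_or] at hω
      exact not_not.1 hω.1 J (not_not.1 hω.2 J hJ)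
  · intro n hn Q Ω _ P _ H hH
    have h0 : 0 ≤ (Real.exp 1 / 2) ^ (-(n : ℝ)) := by positivity
    have hbad := hH.prob_not_concentratesOnModerate_le hM h2 hM2 hn
    refine le_trans ?_ (one_sub_measureReal_le P
      (s := {ω | ¬ ConcentratesOnModerate P H M (dMax 𝓜 Q) ω}) ?_)
    · linarith
    · intro ω hω
      refine not_not.1 hω _ fun v hv => ?_
      have h1 : (degree (H ω) v : ℝ) ≤ M * dMax 𝓜 Q := (Finset.mem_filter.1 hv).2
      have h3 : 0 ≤ M * dMax 𝓜 Q := mul_nonneg (by linarith) hH.dMax_nonneg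
      linarith
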